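/- Let $E$ be a 2-polygraph: a set $E_0$ of 0-generators, a set $E_1$ of 1-generators $f:A\to B$ with $A,B\in E_0$, and a set $E_2$ of 2-generators $\alpha:f\Rightarrow g$, where $f,g$ are parallel 1-cells, i.e. paths of 1-generators. Let $E^*$ be the free (strict) 2-category on $E$; we write $\otimes$ for horizontal composition (in diagrammatic order) and $\circ$ for vertical composition. Let $F$ be the following 3-polygraph. * $F_0=E_0$. * $F_1=\{f^n : f\in E_1,\ n\in\mathbb Z\}$, where, for $f:A\to B$ in $E_1$, $f^n:A\to B$ if $n$ is even and $f^n:B\to A$ if $n$ is odd; $n$ is called the winding number. * $F_2$ consists of a generator $\alpha^0:f^0\Rightarrow g^0$ for each $\alpha:f\Rightarrow g$ in $E_2$, and of generators $\eta_{f^n}:\mathrm{id}_B\Rightarrow f^{n-1}\otimes f^n$ and $\varepsilon_{f^n}:f^n\otimes f^{n-1}\Rightarrow \mathrm{id}_A$ for each $f^n:A\to B$ in $F_1$. Here, for a 1-cell $f=a_1\otimes\cdots\otimes a_p$ of $E^*$ with $a_i\in E_1$, we write $f^0=a_1^0\otimes\cdots\otimes a_p^0$; thus $(f_1\otimes\cdots\otimes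 f_m)^0=f_1^0\otimes\cdots\otimes f_m^0$. * $F_3$ consists, for each $f^n\in F_1$, of the rewriting rules $$l_{f^n}:(f^{n-1}\otimes\varepsilon_{f^n})\circ(\eta_{f^n}\otimes f^{n-1})\Rrightarrow f^{n-1},\qquad r_{f^n}:(\varepsilon_{f^n}\otimes f^n)\circ(f^n\otimes\eta_{f^n})\Rrightarrow f^n .$$ Let $F_2^*$ be the set of 2-cells of the free 2-category on the 2-polygraph $(F_0,F_1,F_2)$. A 2-cell $\alpha'\in F_2^*$ rewrites in one step to $\beta'$ if $\alpha'=K(\alpha)$ and $\beta'=K(\beta)$ for some rule $\alpha\Rrightarrow\beta$ in $F_3$ and some unary context $K$ (a 2-cell with one additional 2-generator, a metavariable, occurring exactly once; $K(\alpha)$ is obtained by substituting $\alpha$ for it). A normal form is a 2-cell from which no rewriting step starts. Let $\overline{F^*}$ be the 2-category presented by $F$, i.e. the quotient of this free 2-category by the equivalence relation on 2-cells generated by rewriting. The assignment $A\mapsto A$, $f\mapsto f^0$, $\alpha\mapsto\alpha^0$ (for $\alpha\in E_2$) extends to a 2-functor from $E^*$ to the free 2-category on $(F_0,F_1,F_2)$,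 whose action on all 2-cells is still written $\alpha\mapsto\alpha^0$, and hence to a 2-functor $E^*\to\overline{F^*}$. Then, for all parallel 1-cells $f$ and $g$ of $E^*$ (in particular for $f=f_1\otimes\cdots\otimes f_m$ and $g=g_1\otimes\cdots\otimes g_n$, where $f_1,\dots,f_m$ and $g_1,\dots,g_n$ are parallel lists of composable 1-cells): 1. a 2-cell $f^0\Rightarrow g^0$ in $F_2^*$ which is a normal form does not contain any 2-generator $\eta_{h^k}$ or $\varepsilon_{h^k}$, where $h\in E_1$ and $k\in\mathbb Z$; 2. $\alpha\mapsto\alpha^0$ is a bijection from the 2-cells $f\Rightarrow g$ of $E^*$ to the 2-cells $f^0\Rightarrow g^0$ in $F_2^*$ which are normal forms; 3. the 2-functor $E^*\to\overline{F^*}$ is full and faithful: the induced functors $E^*(A,B)\to\overline{F^*}(A,B)$ are full and faithful for all 0-cells $A$, $B$. -/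

import Mathlib

open CategoryTheory Quiver

universe w w' v v' u u'

/-! ### 2-categories over a free category of 1-cells -/

/-- A (strict) 2-category whose underlying category of 1-cells is the free category on the
quiver `V`: the 0-cells are the vertices, the 1-cells are the paths, horizontal composition of
1-cells is concatenation of paths. `vcomp α β` is the vertical composite "`α`, then `β`" (often
written `β ∘ α`), and `hcomp α β` is the horizontal composite `α ⊗ β`.
Associativity and unitality of `⊗` on 2-cells are heterogeneous equalities, because the two
sides have equal but not syntactically identical boundaries. -/
structure PathTwoCat (V : Type u) [Quiver.{v} V] where
  Cell : ∀ {a b : V}, Path a b → Path a b → Type w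
  id : ∀ {a b : V} (f : Path a b), Cell f f
  vcomp : ∀ {a b : V} {f g h : Path a b}, Cell f g → Cell g h → Cell f h
  hcomp : ∀ {a b c : V} {f f' : Path a b} {g g' : Path b c},
    Cell f f' → Cell g g' → Cell (f.comp g) (f'.comp g')
  id_vcomp : ∀ {a b : V} {f g : Path a b} (α : Cell f g), vcomp (id f) α = α
  vcomp_id : ∀ {a b : V} {f g : Path a b} (α : Cell f g), vcomp α (id g) = α
  vcomp_assoc : ∀ {a b : V} {f g h k : Path a b} (α : Cell f g) (β : Cell g h) (γ : Cell h k),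
    vcomp (vcomp α β) γ = vcomp α (vcomp β γ)
  hcomp_ids : ∀ {a b c : V} (f : Path a b) (g : Path b c),
    hcomp (id f) (id g) = id (f.comp g)
  interchange : ∀ {a b c : V} {f f' f'' : Path a b} {g g' g'' : Path b c}
    (α : Cell f f') (α' : Cell f' f'') (β : Cell g g') (β' : Cell g' g''),
    hcomp (vcomp α α') (vcomp β β') = vcomp (hcomp α β) (hcomp α' β')
  hcomp_assoc : ∀ {a b c d : V} {f f' : Path a b} {g g' : Path b c} {h h' : Path c d}
    (α : Cell f f') (β : Cell g g') (γ : Cell h h'),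
    hcomp (hcomp α β) γ ≍ hcomp α (hcomp β γ)
  id_hcomp : ∀ {a b : V} {f f' : Path a b} (α : Cell f f'),
    hcomp (id (Path.nil : Path a a)) α ≍ α
  hcomp_id : ∀ {a b : V} {f f' : Path a b} (α : Cell f f'),
    hcomp α (id (Path.nil : Path b b)) ≍ α

namespace PathTwoCat

section

variable {V : Type u} [Quiver.{v} V]

/-- The type of 0-cells of a `PathTwoCat`, on which it is a bicategory in Mathlib's sense. -/
@[nolint unusedArguments]
def Obj (_C : PathTwoCat.{w} V) : Type u := V

variable (C : PathTwoCat.{w} V)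

theorem vcomp_heq {a b : V} {f g h f' g' h' : Path a b} (hf : f = f') (hg : g = g') (hh : h = h')
    {α : C.Cell f g} {β : C.Cell g h} {α' : C.Cell f' g'} {β' : C.Cell g' h'}
    (hα : α ≍ α') (hβ : β ≍ β') : C.vcomp α β ≍ C.vcomp α' β' := by
  subst hf hg hh
  rw [eq_of_heq hα, eq_of_heq hβ]

theorem hcomp_heq {a b c : V} {f g f' g' : Path a b} {h k h' k' : Path b c}
    (hf : f = f') (hg : g = g') (hh : h = h') (hk : k = k')
    {α : C.Cell f g} {β : C.Cell h k} {α' : C.Cell f' g'} {β' : C.Cell h' k'}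
    (hα : α ≍ α') (hβ : β ≍ β') : C.hcomp α β ≍ C.hcomp α' β' := by
  subst hf hg hh hk
  rw [eq_of_heq hα, eq_of_heq hβ]

theorem hcomp_id_vcomp {a b c : V} (f : Path a b) {g h k : Path b c} (η : C.Cell g h)
    (θ : C.Cell h k) :
    C.hcomp (C.id f) (C.vcomp η θ) = C.vcomp (C.hcomp (C.id f) η) (C.hcomp (C.id f) θ) := by
  rw [← C.interchange, C.id_vcomp]

theorem hcomp_vcomp_id {a b c : V} {f g h : Path a b} (η : C.Cell f g) (θ : C.Cell g h)
    (k : Path b c) :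
    C.hcomp (C.vcomp η θ) (C.id k) = C.vcomp (C.hcomp η (C.id k)) (C.hcomp θ (C.id k)) := by
  rw [← C.interchange, C.id_vcomp]

theorem exchange {a b c : V} {f g : Path a b} {h k : Path b c} (η : C.Cell f g)
    (θ : C.Cell h k) :
    C.vcomp (C.hcomp (C.id f) θ) (C.hcomp η (C.id k)) =
      C.vcomp (C.hcomp η (C.id h)) (C.hcomp (C.id g) θ) := by
  rw [← C.interchange, ← C.interchange, C.id_vcomp, C.vcomp_id, C.vcomp_id, C.id_vcomp]

theorem hcomp_comp_id_left {a b c d : V} (f : Path a b) (g : Path b c) {h h' : Path c d}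
    (η : C.Cell h h') :
    C.hcomp (C.id (f.comp g)) η ≍ C.hcomp (C.id f) (C.hcomp (C.id g) η) := by
  rw [← C.hcomp_ids]; exact C.hcomp_assoc _ _ _

theorem hcomp_comp_id_right {a b c d : V} {f f' : Path a b} (η : C.Cell f f') (g : Path b c)
    (h : Path c d) :
    C.hcomp η (C.id (g.comp h)) ≍ C.hcomp (C.hcomp η (C.id g)) (C.id h) := by
  rw [← C.hcomp_ids]; exact (C.hcomp_assoc _ _ _).symm

instance : CategoryStruct.{max u v} C.Obj where
  Hom a b := @Path V _ a b
  id a := @Path.nil V _ a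
  comp f g := @Path.comp V _ _ _ _ f g

instance homCategory (a b : C.Obj) : Category.{w} (a ⟶ b) where
  Hom f g := C.Cell f g
  id f := C.id f
  comp α β := C.vcomp α β
  id_comp α := C.id_vcomp α
  comp_id α := C.vcomp_id α
  assoc α β γ := C.vcomp_assoc α β γ

theorem eqToHom_heq {a b : C.Obj} {f g : a ⟶ b} (h : f = g) : eqToHom h ≍ 𝟙 f := by
  subst h; rfl

theorem conj_heq {a b : C.Obj} {f g f' g' : a ⟶ b} (hf : f' = f) (hg : g = g') (α : f ⟶ g) :
    eqToHom hf ≫ α ≫ eqToHom hg ≍ α := by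
  subst hf hg; simp

theorem hcomp_eqToHom_id {a b c : C.Obj} {f g : a ⟶ b} (h : f = g) (k : b ⟶ c) :
    C.hcomp (eqToHom h : f ⟶ g) (C.id k) =
      (eqToHom (congrArg (· ≫ k) h) : f ≫ k ⟶ g ≫ k) := by
  subst h; exact C.hcomp_ids f k

theorem hcomp_id_eqToHom {a b c : C.Obj} (k : a ⟶ b) {f g : b ⟶ c} (h : f = g) :
    C.hcomp (C.id k) (eqToHom h : f ⟶ g) =
      (eqToHom (congrArg (k ≫ ·) h) : k ≫ f ⟶ k ≫ g) := by
  subst h; exact C.hcomp_ids k f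

instance : Bicategory.{w} C.Obj where
  homCategory a b := C.homCategory a b
  whiskerLeft f _ _ β := C.hcomp (C.id f) β
  whiskerRight α h := C.hcomp α (C.id h)
  associator f g h := eqToIso (Path.comp_assoc f g h)
  leftUnitor f := eqToIso (Path.nil_comp f)
  rightUnitor f := eqToIso (Path.comp_nil f)
  whiskerLeft_id f g := C.hcomp_ids f g
  whiskerLeft_comp f _ _ _ η θ := C.hcomp_id_vcomp f η θ
  id_whiskerLeft {_ _ f g} η := eq_of_heq <|
    (C.id_hcomp η).trans (C.conj_heq (Path.nil_comp f) (Path.nil_comp g).symm η).symm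
  comp_whiskerLeft {_ _ _ _} f g {h h'} η := eq_of_heq <|
    (C.hcomp_comp_id_left f g η).trans
      (C.conj_heq (Path.comp_assoc f g h) (Path.comp_assoc f g h').symm _).symm
  id_whiskerRight f g := C.hcomp_ids f g
  comp_whiskerRight η θ i := C.hcomp_vcomp_id η θ i
  whiskerRight_id {_ _ f g} η := eq_of_heq <|
    (C.hcomp_id η).trans (C.conj_heq (Path.comp_nil f) (Path.comp_nil g).symm η).symm
  whiskerRight_comp {_ _ _ _ f f'} η g h := eq_of_heq <|
    (C.hcomp_comp_id_right η g h).trans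
      (C.conj_heq (Path.comp_assoc f g h).symm (Path.comp_assoc f' g h) _).symm
  whisker_assoc {_ _ _ _} f {g g'} η h := eq_of_heq <|
    (C.hcomp_assoc (C.id f) η (C.id h)).trans
      (C.conj_heq (Path.comp_assoc f g h) (Path.comp_assoc f g' h).symm _).symm
  whisker_exchange η θ := C.exchange η θ
  pentagon {_ _ _ _ _} f g h i := by
    simp only [eqToIso.hom, hcomp_eqToHom_id, hcomp_id_eqToHom, eqToHom_trans]
  triangle {_ _ _} f g := by
    simp only [eqToIso.hom, hcomp_eqToHom_id, hcomp_id_eqToHom, eqToHom_trans]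

instance : Bicategory.Strict C.Obj where
  id_comp f := Path.nil_comp f
  comp_id f := Path.comp_nil f
  assoc f g h := Path.comp_assoc f g h
  leftUnitor_eqToIso _ := rfl
  rightUnitor_eqToIso _ := rfl
  associator_eqToIso _ _ _ := rfl

/-- Transport of a 2-cell along equalities of 1-cells. -/
def castCell {a b : V} {f g f' g' : Path a b} (hf : f = f') (hg : g = g') (α : C.Cell f g) :
    C.Cell f' g' :=
  hf ▸ hg ▸ α

theorem castCell_heq {a b : V} {f g f' g' : Path a b} (hf : f = f') (hg : g = g')
    (α : C.Cell f g) : C.castCell hf hg α ≍ α := by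
  subst hf hg; rfl

variable {W : Type u'} [Quiver.{v'} W] (D : PathTwoCat.{w} W)

/-- Given a morphism of graphs `φ : V → W`, the 2-category on `V` whose 2-cells `f ⇒ g` are the
2-cells `φ f ⇒ φ g` of `D`. -/
def comap (φ : V ⥤q W) : PathTwoCat.{w} V where
  Cell f g := D.Cell (φ.mapPath f) (φ.mapPath g)
  id f := D.id (φ.mapPath f)
  vcomp α β := D.vcomp α β
  hcomp α β := D.castCell (φ.mapPath_comp _ _).symm (φ.mapPath_comp _ _).symm (D.hcomp α β)
  id_vcomp α := D.id_vcomp α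
  vcomp_id α := D.vcomp_id α
  vcomp_assoc α β γ := D.vcomp_assoc α β γ
  hcomp_ids f g := by
    rw [D.hcomp_ids]
    refine eq_of_heq ((D.castCell_heq _ _ _).trans ?_)
    rw [φ.mapPath_comp]
  interchange {_ _ _ f f' f'' g g' g''} α α' β β' := by
    rw [D.interchange]
    exact eq_of_heq ((D.castCell_heq _ _ _).trans
      (D.vcomp_heq (φ.mapPath_comp f g).symm (φ.mapPath_comp f' g').symm
        (φ.mapPath_comp f'' g'').symm (D.castCell_heq _ _ _).symm (D.castCell_heq _ _ _).symm))
  hcomp_assoc {_ _ _ _ f f' g g' h h'} α β γ := by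
    refine (D.castCell_heq _ _ _).trans (HEq.trans ?_ (D.castCell_heq _ _ _).symm)
    refine (D.hcomp_heq (φ.mapPath_comp f g) (φ.mapPath_comp f' g') rfl rfl
      (D.castCell_heq _ _ _) HEq.rfl).trans ?_
    refine (D.hcomp_assoc α β γ).trans ?_
    exact (D.hcomp_heq rfl rfl (φ.mapPath_comp g h) (φ.mapPath_comp g' h') HEq.rfl
      (D.castCell_heq _ _ _)).symm
  id_hcomp α := (D.castCell_heq _ _ _).trans (D.id_hcomp α)
  hcomp_id α := (D.castCell_heq _ _ _).trans (D.hcomp_id α)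

end

end PathTwoCat

/-! ### Polygraphs and the free 2-category on a 2-polygraph -/

/-- A 2-polygraph `E` whose 0-generators are the elements of `V` and whose 1-generators are the
arrows of the quiver `V`. The 1-cells of the free category are the paths in `V`, and `E.Gen f g`
is the set of 2-generators with source `f` and target `g`. -/
structure TwoPolygraph (V : Type u) [Quiver.{v} V] where
  Gen : ∀ {a b : V}, Path a b → Path a b → Type w

namespace TwoPolygraph

section

variable {V : Type u} [Quiver.{v} V]

/-- Formal vertical and horizontal composites of 2-generators. -/
inductive Term (E : TwoPolygraph.{w} V) : ∀ {a b : V}, Path a b → Path a b → Type (max u v w)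
  | gen {a b : V} {f g : Path a b} (α : E.Gen f g) : Term E f g
  | id {a b : V} (f : Path a b) : Term E f f
  | vcomp {a b : V} {f g h : Path a b} (s : Term E f g) (t : Term E g h) : Term E f h
  | hcomp {a b c : V} {f f' : Path a b} {g g' : Path b c} (s : Term E f f') (t : Term E g g') :
      Term E (f.comp g) (f'.comp g')

/-- The congruence on formal composites generated by the axioms of 2-categories. It is a relation
between terms with possibly different boundaries; related terms have in fact equal boundaries
(`Term.Rel.boundary_eq`). -/
inductive Term.Rel {E : TwoPolygraph.{w} V} :
    ∀ {a b : V} {f g f' g' : Path a b}, E.Term f g → E.Term f' g' → Prop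
  | refl {a b : V} {f g : Path a b} (s : E.Term f g) : Rel s s
  | symm {a b : V} {f g f' g' : Path a b} {s : E.Term f g} {t : E.Term f' g'} :
      Rel s t → Rel t s
  | trans {a b : V} {f g f' g' f'' g'' : Path a b} {s : E.Term f g} {t : E.Term f' g'}
      {r : E.Term f'' g''} : Rel s t → Rel t r → Rel s r
  | vcomp_congr {a b : V} {f g h f' g' h' : Path a b} {s : E.Term f g} {t : E.Term g h}
      {s' : E.Term f' g'} {t' : E.Term g' h'} :
      Rel s s' → Rel t t' → Rel (s.vcomp t) (s'.vcomp t')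
  | hcomp_congr {a b c : V} {f g f' g' : Path a b} {h k h' k' : Path b c} {s : E.Term f g}
      {t : E.Term h k} {s' : E.Term f' g'} {t' : E.Term h' k'} :
      Rel s s' → Rel t t' → Rel (s.hcomp t) (s'.hcomp t')
  | id_vcomp {a b : V} {f g : Path a b} (s : E.Term f g) : Rel ((Term.id f).vcomp s) s
  | vcomp_id {a b : V} {f g : Path a b} (s : E.Term f g) : Rel (s.vcomp (Term.id g)) s
  | vcomp_assoc {a b : V} {f g h k : Path a b} (s : E.Term f g) (t : E.Term g h)
      (r : E.Term h k) : Rel ((s.vcomp t).vcomp r) (s.vcomp (t.vcomp r))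
  | hcomp_ids {a b c : V} (f : Path a b) (g : Path b c) :
      Rel ((Term.id f).hcomp (Term.id g)) (Term.id (f.comp g))
  | interchange {a b c : V} {f f' f'' : Path a b} {g g' g'' : Path b c} (s : E.Term f f')
      (s' : E.Term f' f'') (t : E.Term g g') (t' : E.Term g' g'') :
      Rel ((s.vcomp s').hcomp (t.vcomp t')) ((s.hcomp t).vcomp (s'.hcomp t'))
  | hcomp_assoc {a b c d : V} {f f' : Path a b} {g g' : Path b c} {h h' : Path c d}
      (s : E.Term f f') (t : E.Term g g') (r : E.Term h h') :
      Rel ((s.hcomp t).hcomp r) (s.hcomp (t.hcomp r))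
  | id_hcomp {a b : V} {f f' : Path a b} (s : E.Term f f') :
      Rel ((Term.id (Path.nil : Path a a)).hcomp s) s
  | hcomp_id {a b : V} {f f' : Path a b} (s : E.Term f f') :
      Rel (s.hcomp (Term.id (Path.nil : Path b b))) s

theorem Term.Rel.boundary_eq {E : TwoPolygraph.{w} V} {a b : V} {f g f' g' : Path a b}
    {s : E.Term f g} {t : E.Term f' g'} (h : Term.Rel s t) : f = f' ∧ g = g' := by
  induction h with
  | symm _ ih => exact ⟨ih.1.symm, ih.2.symm⟩
  | trans _ _ ih ih' => exact ⟨ih.1.trans ih'.1, ih.2.trans ih'.2⟩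
  | vcomp_congr _ _ ih ih' => exact ⟨ih.1, ih'.2⟩
  | hcomp_congr _ _ ih ih' => rw [ih.1, ih.2, ih'.1, ih'.2]; exact ⟨rfl, rfl⟩
  | hcomp_assoc => simp
  | id_hcomp => simp
  | _ => exact ⟨rfl, rfl⟩

/-- The 2-cells of the free 2-category: formal composites modulo the axioms of 2-categories. -/
def FreeCell (E : TwoPolygraph.{w} V) {a b : V} (f g : Path a b) : Type (max u v w) :=
  Quot fun s t : E.Term f g => Term.Rel s t

theorem Term.Rel.mk_heq {E : TwoPolygraph.{w} V} {a b : V} {f g f' g' : Path a b}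
    {s : E.Term f g} {t : E.Term f' g'} (h : Term.Rel s t) :
    (Quot.mk _ s : E.FreeCell f g) ≍ (Quot.mk _ t : E.FreeCell f' g') := by
  obtain ⟨rfl, rfl⟩ := h.boundary_eq
  exact heq_of_eq (Quot.sound h)

/-- The free 2-category `E^*` on a 2-polygraph `E`. -/
def free (E : TwoPolygraph.{w} V) : PathTwoCat.{max u v w} V where
  Cell f g := E.FreeCell f g
  id f := Quot.mk _ (Term.id f)
  vcomp := Quot.map₂ Term.vcomp (fun s _ _ h => (Term.Rel.refl s).vcomp_congr h)
    (fun _ _ t h => h.vcomp_congr (Term.Rel.refl t))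
  hcomp := Quot.map₂ Term.hcomp (fun s _ _ h => (Term.Rel.refl s).hcomp_congr h)
    (fun _ _ t h => h.hcomp_congr (Term.Rel.refl t))
  id_vcomp := by rintro _ _ _ _ ⟨s⟩; exact Quot.sound (.id_vcomp s)
  vcomp_id := by rintro _ _ _ _ ⟨s⟩; exact Quot.sound (.vcomp_id s)
  vcomp_assoc := by rintro _ _ _ _ _ _ ⟨s⟩ ⟨t⟩ ⟨r⟩; exact Quot.sound (.vcomp_assoc s t r)
  hcomp_ids f g := Quot.sound (.hcomp_ids f g)
  interchange := by
    rintro _ _ _ _ _ _ _ _ _ ⟨s⟩ ⟨s'⟩ ⟨t⟩ ⟨t'⟩; exact Quot.sound (.interchange s s' t t')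
  hcomp_assoc := by
    rintro _ _ _ _ _ _ _ _ _ _ ⟨s⟩ ⟨t⟩ ⟨r⟩; exact (Term.Rel.hcomp_assoc s t r).mk_heq
  id_hcomp := by rintro _ _ _ _ ⟨s⟩; exact (Term.Rel.id_hcomp s).mk_heq
  hcomp_id := by rintro _ _ _ _ ⟨s⟩; exact (Term.Rel.hcomp_id s).mk_heq

/-- A 2-generator, seen as a 2-cell of the free 2-category. -/
def of (E : TwoPolygraph.{w} V) {a b : V} {f g : Path a b} (α : E.Gen f g) : E.free.Cell f g :=
  Quot.mk _ (Term.gen α)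

/-- Evaluation of a formal composite in a 2-category, given the images of the 2-generators. -/
def Term.eval {E : TwoPolygraph.{w} V} (C : PathTwoCat.{w'} V)
    (σ : ∀ {a b : V} {f g : Path a b}, E.Gen f g → C.Cell f g) :
    ∀ {a b : V} {f g : Path a b}, E.Term f g → C.Cell f g
  | _, _, _, _, .gen α => σ α
  | _, _, _, _, .id f => C.id f
  | _, _, _, _, .vcomp s t => C.vcomp (s.eval C σ) (t.eval C σ)
  | _, _, _, _, .hcomp s t => C.hcomp (s.eval C σ) (t.eval C σ)

theorem Term.Rel.eval_heq {E : TwoPolygraph.{w} V} (C : PathTwoCat.{w'} V)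
    (σ : ∀ {a b : V} {f g : Path a b}, E.Gen f g → C.Cell f g) {a b : V}
    {f g f' g' : Path a b} {s : E.Term f g} {t : E.Term f' g'} (h : Term.Rel s t) :
    s.eval C σ ≍ t.eval C σ := by
  induction h with
  | refl => rfl
  | symm _ ih => exact ih.symm
  | trans _ _ ih ih' => exact ih.trans ih'
  | vcomp_congr h h' ih ih' =>
    exact C.vcomp_heq h.boundary_eq.1 h.boundary_eq.2 h'.boundary_eq.2 ih ih'
  | hcomp_congr h h' ih ih' =>
    exact C.hcomp_heq h.boundary_eq.1 h.boundary_eq.2 h'.boundary_eq.1 h'.boundary_eq.2 ih ih'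
  | id_vcomp => exact heq_of_eq (C.id_vcomp _)
  | vcomp_id => exact heq_of_eq (C.vcomp_id _)
  | vcomp_assoc => exact heq_of_eq (C.vcomp_assoc _ _ _)
  | hcomp_ids => exact heq_of_eq (C.hcomp_ids _ _)
  | interchange => exact heq_of_eq (C.interchange _ _ _ _)
  | hcomp_assoc => exact C.hcomp_assoc _ _ _
  | id_hcomp => exact C.id_hcomp _
  | hcomp_id => exact C.hcomp_id _

/-- The universal property of the free 2-category: the 2-functor `E^* → C` which is the identity
on 0-cells and on 1-cells and sends each 2-generator `α` to `σ α`. -/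
def eval {E : TwoPolygraph.{w} V} (C : PathTwoCat.{w'} V)
    (σ : ∀ {a b : V} {f g : Path a b}, E.Gen f g → C.Cell f g) {a b : V} {f g : Path a b} :
    E.free.Cell f g → C.Cell f g :=
  Quot.lift (fun s => s.eval C σ) fun _ _ h => eq_of_heq (h.eval_heq C σ)

theorem eval_vcomp {E : TwoPolygraph.{w} V} (C : PathTwoCat.{w'} V)
    (σ : ∀ {a b : V} {f g : Path a b}, E.Gen f g → C.Cell f g) {a b : V} {f g h : Path a b}
    (α : E.free.Cell f g) (β : E.free.Cell g h) :
    eval C σ (E.free.vcomp α β) = C.vcomp (eval C σ α) (eval C σ β) := by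
  obtain ⟨s⟩ := α; obtain ⟨t⟩ := β; rfl

theorem eval_hcomp {E : TwoPolygraph.{w} V} (C : PathTwoCat.{w'} V)
    (σ : ∀ {a b : V} {f g : Path a b}, E.Gen f g → C.Cell f g) {a b c : V} {f f' : Path a b}
    {g g' : Path b c} (α : E.free.Cell f f') (β : E.free.Cell g g') :
    eval C σ (E.free.hcomp α β) = C.hcomp (eval C σ α) (eval C σ β) := by
  obtain ⟨s⟩ := α; obtain ⟨t⟩ := β; rfl

/-- The universal property of the free 2-category, with respect to 2-functors which need not be the
identity on 0-cells and 1-cells: given a morphism `φ` of graphs and, for each 2-generator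
`α : f ⇒ g`, a 2-cell `σ α : φ f ⇒ φ g` of `C`, the induced 2-functor `E^* → C`. -/
def lift {W : Type u'} [Quiver.{v'} W] {E : TwoPolygraph.{w} V} (φ : V ⥤q W)
    (C : PathTwoCat.{w'} W)
    (σ : ∀ {a b : V} {f g : Path a b}, E.Gen f g → C.Cell (φ.mapPath f) (φ.mapPath g)) :
    StrictPseudofunctor E.free.Obj C.Obj :=
  StrictPseudofunctor.mk''
    { obj := fun a => φ.obj a
      map := fun f => φ.mapPath f
      map₂ := fun α => eval (C.comap φ) σ α
      map₂_id := fun _ => rfl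
      map₂_comp := fun α β => eval_vcomp (C.comap φ) σ α β
      map_id := fun _ => rfl
      map_comp := fun f g => φ.mapPath_comp f g
      map₂_whisker_left := fun {_ _ _} f {g g'} η => by
        refine (eval_hcomp (C.comap φ) σ (E.free.id f) η).trans (eq_of_heq ?_)
        exact (C.castCell_heq _ _ _).trans
          (C.conj_heq (φ.mapPath_comp f g) (φ.mapPath_comp f g').symm _).symm
      map₂_whisker_right := fun {_ _ _ f f'} η g => by
        refine (eval_hcomp (C.comap φ) σ η (E.free.id g)).trans (eq_of_heq ?_)
        exact (C.castCell_heq _ _ _).trans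
          (C.conj_heq (φ.mapPath_comp f g) (φ.mapPath_comp f' g).symm _).symm }

/-! ### Weights, contexts and rewriting -/

/-- The 2-category with natural numbers as 2-cells, both compositions being addition. -/
def additive (V : Type u) [Quiver.{v} V] : PathTwoCat.{0} V where
  Cell _ _ := ℕ
  id _ := 0
  vcomp m n := m + n
  hcomp m n := m + n
  id_vcomp := Nat.zero_add
  vcomp_id := Nat.add_zero
  vcomp_assoc := Nat.add_assoc
  hcomp_ids _ _ := rfl
  interchange := Nat.add_add_add_comm
  hcomp_assoc _ _ _ := heq_of_eq (Nat.add_assoc _ _ _)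
  id_hcomp _ := heq_of_eq (Nat.zero_add _)
  hcomp_id _ := heq_of_eq (Nat.add_zero _)

/-- The weight of a 2-cell: each occurrence of a 2-generator `α` counts for `φ α`. -/
def weight {E : TwoPolygraph.{w} V} (φ : ∀ {a b : V} {f g : Path a b}, E.Gen f g → ℕ) {a b : V}
    {f g : Path a b} (β : E.free.Cell f g) : ℕ :=
  eval (additive V) φ β

/-- The 2-generators of `E[f ⇒ g]`: those of `E` and a metavariable `X : f ⇒ g`. -/
inductive AdjoinGen (E : TwoPolygraph.{w} V) {a b : V} (f g : Path a b) :
    ∀ {c d : V}, Path c d → Path c d → Type (max u v w)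
  | old {c d : V} {h k : Path c d} (α : E.Gen h k) : AdjoinGen E f g h k
  | var : AdjoinGen E f g f g

/-- The 2-polygraph `E[f ⇒ g]`. -/
abbrev adjoin (E : TwoPolygraph.{w} V) {a b : V} (f g : Path a b) :
    TwoPolygraph.{max u v w} V where
  Gen h k := E.AdjoinGen f g h k

/-- The indicator function of the metavariable. -/
def isVar {E : TwoPolygraph.{w} V} {a b : V} {f g : Path a b} {c d : V} {h k : Path c d} :
    (E.adjoin f g).Gen h k → ℕ
  | AdjoinGen.old _ => 0
  | AdjoinGen.var => 1

/-- The interpretation of generators of `E[f ⇒ g]` in `E^*` sending the metavariable to `α`. -/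
def substVar {E : TwoPolygraph.{w} V} {a b : V} {f g : Path a b} (α : E.free.Cell f g)
    {c d : V} {h k : Path c d} : (E.adjoin f g).Gen h k → E.free.Cell h k
  | AdjoinGen.old β => E.of β
  | AdjoinGen.var => α

/-- A unary context `K : (f ⇒ g) → (h ⇒ k)`: a 2-cell `h ⇒ k` of `E[f ⇒ g]^*` in which the
metavariable occurs exactly once. -/
structure Context (E : TwoPolygraph.{w} V) {a b : V} (f g : Path a b) {c d : V}
    (h k : Path c d) where
  cell : (E.adjoin f g).free.Cell h k
  weight_var : weight isVar cell = 1

/-- `K(α)`: the metavariable of the context `K` is replaced by `α`. -/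
def Context.apply {E : TwoPolygraph.{w} V} {a b : V} {f g : Path a b} {c d : V}
    {h k : Path c d} (K : E.Context f g h k) (α : E.free.Cell f g) : E.free.Cell h k :=
  eval E.free (substVar α) K.cell

/-- The inclusion `E^* → E[f ⇒ g]^*`. -/
def incl {E : TwoPolygraph.{w} V} {a b : V} (f g : Path a b) {c d : V} {h k : Path c d}
    (β : E.free.Cell h k) : (E.adjoin f g).free.Cell h k :=
  eval (E.adjoin f g).free (fun α => (E.adjoin f g).of (AdjoinGen.old α)) β

theorem incl_vcomp {E : TwoPolygraph.{w} V} {a b : V} (f g : Path a b) {c d : V}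
    {h k l : Path c d} (β : E.free.Cell h k) (γ : E.free.Cell k l) :
    incl f g (E.free.vcomp β γ) = (E.adjoin f g).free.vcomp (incl f g β) (incl f g γ) :=
  eval_vcomp _ _ β γ

theorem incl_hcomp {E : TwoPolygraph.{w} V} {a b : V} (f g : Path a b) {c d e : V}
    {h h' : Path c d} {k k' : Path d e} (β : E.free.Cell h h') (γ : E.free.Cell k k') :
    incl f g (E.free.hcomp β γ) = (E.adjoin f g).free.hcomp (incl f g β) (incl f g γ) :=
  eval_hcomp _ _ β γ

theorem weight_vcomp {E : TwoPolygraph.{w} V}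
    (φ : ∀ {a b : V} {f g : Path a b}, E.Gen f g → ℕ) {c d : V}
    {h k l : Path c d} (β : E.free.Cell h k) (γ : E.free.Cell k l) :
    weight φ (E.free.vcomp β γ) = weight φ β + weight φ γ :=
  eval_vcomp _ _ β γ

theorem weight_hcomp {E : TwoPolygraph.{w} V}
    (φ : ∀ {a b : V} {f g : Path a b}, E.Gen f g → ℕ) {c d e : V}
    {h h' : Path c d} {k k' : Path d e} (β : E.free.Cell h h') (γ : E.free.Cell k k') :
    weight φ (E.free.hcomp β γ) = weight φ β + weight φ γ :=
  eval_hcomp _ _ β γ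

theorem weight_incl {E : TwoPolygraph.{w} V} {a b : V} (f g : Path a b) {c d : V}
    {h k : Path c d} (β : E.free.Cell h k) :
    weight isVar (incl f g β) = 0 := by
  obtain ⟨t⟩ := β
  induction t with
  | gen => rfl
  | id => rfl
  | vcomp s t hs ht =>
    refine (congrArg (weight _) (incl_vcomp f g (Quot.mk _ s) (Quot.mk _ t))).trans ?_
    rw [weight_vcomp, hs (Quot.mk _ s), ht (Quot.mk _ t)]
  | hcomp s t hs ht =>
    refine (congrArg (weight _) (incl_hcomp f g (Quot.mk _ s) (Quot.mk _ t))).trans ?_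
    rw [weight_hcomp, hs (Quot.mk _ s), ht (Quot.mk _ t)]

theorem eval_subst_incl {E : TwoPolygraph.{w} V} {a b : V} {f g : Path a b}
    (α : E.free.Cell f g) {c d : V} {h k : Path c d} (β : E.free.Cell h k) :
    eval E.free (substVar α) (incl f g β) = β := by
  obtain ⟨t⟩ := β
  induction t with
  | gen => rfl
  | id => rfl
  | vcomp s t hs ht =>
    refine (congrArg (eval _ _) (incl_vcomp f g (Quot.mk _ s) (Quot.mk _ t))).trans ?_
    rw [eval_vcomp, hs (Quot.mk _ s), ht (Quot.mk _ t)]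
    rfl
  | hcomp s t hs ht =>
    refine (congrArg (eval _ _) (incl_hcomp f g (Quot.mk _ s) (Quot.mk _ t))).trans ?_
    rw [eval_hcomp, hs (Quot.mk _ s), ht (Quot.mk _ t)]
    rfl

/-- The context `K ∘ γ`. -/
def Context.vcompLeft {E : TwoPolygraph.{w} V} {a b : V} {f g : Path a b} {c d : V}
    {h k l : Path c d} (γ : E.free.Cell h k) (K : E.Context f g k l) : E.Context f g h l where
  cell := (E.adjoin f g).free.vcomp (incl f g γ) K.cell
  weight_var := by rw [weight_vcomp, weight_incl, K.weight_var]

/-- The context `γ ∘ K`. -/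
def Context.vcompRight {E : TwoPolygraph.{w} V} {a b : V} {f g : Path a b} {c d : V}
    {h k l : Path c d} (K : E.Context f g h k) (γ : E.free.Cell k l) : E.Context f g h l where
  cell := (E.adjoin f g).free.vcomp K.cell (incl f g γ)
  weight_var := by rw [weight_vcomp, weight_incl, K.weight_var]

/-- The context `γ ⊗ K`. -/
def Context.hcompLeft {E : TwoPolygraph.{w} V} {a b : V} {f g : Path a b} {c d e : V}
    {h h' : Path c d} {k k' : Path d e} (γ : E.free.Cell h h') (K : E.Context f g k k') :
    E.Context f g (h.comp k) (h'.comp k') where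
  cell := (E.adjoin f g).free.hcomp (incl f g γ) K.cell
  weight_var := by rw [weight_hcomp, weight_incl, K.weight_var]

/-- The context `K ⊗ γ`. -/
def Context.hcompRight {E : TwoPolygraph.{w} V} {a b : V} {f g : Path a b} {c d e : V}
    {h h' : Path c d} {k k' : Path d e} (K : E.Context f g h h') (γ : E.free.Cell k k') :
    E.Context f g (h.comp k) (h'.comp k') where
  cell := (E.adjoin f g).free.hcomp K.cell (incl f g γ)
  weight_var := by rw [weight_hcomp, weight_incl, K.weight_var]

theorem Context.apply_vcompLeft {E : TwoPolygraph.{w} V} {a b : V} {f g : Path a b} {c d : V}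
    {h k l : Path c d} (γ : E.free.Cell h k) (K : E.Context f g k l) (α : E.free.Cell f g) :
    (K.vcompLeft γ).apply α = E.free.vcomp γ (K.apply α) := by
  rw [apply, vcompLeft, eval_vcomp, eval_subst_incl, apply]

theorem Context.apply_vcompRight {E : TwoPolygraph.{w} V} {a b : V} {f g : Path a b} {c d : V}
    {h k l : Path c d} (K : E.Context f g h k) (γ : E.free.Cell k l) (α : E.free.Cell f g) :
    (K.vcompRight γ).apply α = E.free.vcomp (K.apply α) γ := by
  rw [apply, vcompRight, eval_vcomp, eval_subst_incl, apply]

theorem Context.apply_hcompLeft {E : TwoPolygraph.{w} V} {a b : V} {f g : Path a b}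
    {c d e : V} {h h' : Path c d} {k k' : Path d e} (γ : E.free.Cell h h')
    (K : E.Context f g k k') (α : E.free.Cell f g) :
    (K.hcompLeft γ).apply α = E.free.hcomp γ (K.apply α) := by
  rw [apply, hcompLeft, eval_hcomp, eval_subst_incl, apply]

theorem Context.apply_hcompRight {E : TwoPolygraph.{w} V} {a b : V} {f g : Path a b}
    {c d e : V} {h h' : Path c d} {k k' : Path d e} (K : E.Context f g h h')
    (γ : E.free.Cell k k') (α : E.free.Cell f g) :
    (K.hcompRight γ).apply α = E.free.hcomp (K.apply α) γ := by
  rw [apply, hcompRight, eval_hcomp, eval_subst_incl, apply]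

end

end TwoPolygraph

/-- A 3-polygraph on the graph `V`: a 2-polygraph together with, for each pair of parallel
2-cells `α`, `β` of the free 2-category, a set `Gen₃ α β` of 3-generators (rewriting rules)
from `α` to `β`. -/
structure ThreePolygraph (V : Type u) [Quiver.{v} V] extends TwoPolygraph.{w} V where
  Gen₃ : ∀ {a b : V} {f g : Path a b},
    toTwoPolygraph.free.Cell f g → toTwoPolygraph.free.Cell f g → Type w

namespace ThreePolygraph

section

variable {V : Type u} [Quiver.{v} V]

/-- One-step rewriting: `α'` rewrites to `β'` if `α' = K(α)` and `β' = K(β)` for some 3-generator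
from `α` to `β` and some unary context `K`. -/
inductive Step (F : ThreePolygraph.{w} V) {c d : V} {h k : Path c d} :
    F.free.Cell h k → F.free.Cell h k → Prop
  | mk {a b : V} {f g : Path a b} {α β : F.free.Cell f g} (r : F.Gen₃ α β)
      (K : F.Context f g h k) : Step F (K.apply α) (K.apply β)

/-- A 2-cell is a normal form if no rewriting step starts from it. -/
def IsNormalForm (F : ThreePolygraph.{w} V) {c d : V} {h k : Path c d}
    (α : F.free.Cell h k) : Prop :=
  ∀ β : F.free.Cell h k, ¬ F.Step α β

theorem Step.vcomp_left {F : ThreePolygraph.{w} V} {c d : V} {h k l : Path c d}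
    (γ : F.free.Cell h k) {α β : F.free.Cell k l} (s : F.Step α β) :
    F.Step (F.free.vcomp γ α) (F.free.vcomp γ β) := by
  obtain ⟨r, K⟩ := s
  rw [← TwoPolygraph.Context.apply_vcompLeft, ← TwoPolygraph.Context.apply_vcompLeft]
  exact .mk r _

theorem Step.vcomp_right {F : ThreePolygraph.{w} V} {c d : V} {h k l : Path c d}
    {α β : F.free.Cell h k} (s : F.Step α β) (γ : F.free.Cell k l) :
    F.Step (F.free.vcomp α γ) (F.free.vcomp β γ) := by
  obtain ⟨r, K⟩ := s
  rw [← TwoPolygraph.Context.apply_vcompRight, ← TwoPolygraph.Context.apply_vcompRight]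
  exact .mk r _

theorem Step.hcomp_left {F : ThreePolygraph.{w} V} {c d e : V} {h h' : Path c d}
    {k k' : Path d e} (γ : F.free.Cell h h') {α β : F.free.Cell k k'} (s : F.Step α β) :
    F.Step (F.free.hcomp γ α) (F.free.hcomp γ β) := by
  obtain ⟨r, K⟩ := s
  rw [← TwoPolygraph.Context.apply_hcompLeft, ← TwoPolygraph.Context.apply_hcompLeft]
  exact .mk r _

theorem Step.hcomp_right {F : ThreePolygraph.{w} V} {c d e : V} {h h' : Path c d}
    {k k' : Path d e} {α β : F.free.Cell h h'} (s : F.Step α β) (γ : F.free.Cell k k') :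
    F.Step (F.free.hcomp α γ) (F.free.hcomp β γ) := by
  obtain ⟨r, K⟩ := s
  rw [← TwoPolygraph.Context.apply_hcompRight, ← TwoPolygraph.Context.apply_hcompRight]
  exact .mk r _

theorem mk_heq (F : ThreePolygraph.{w} V) {c d : V} {h k h' k' : Path c d}
    {α : F.free.Cell h k} {β : F.free.Cell h' k'} (hh : h = h') (hk : k = k') (e : α ≍ β) :
    (Quot.mk F.Step α : Quot F.Step) ≍ (Quot.mk F.Step β : Quot F.Step) := by
  subst hh hk
  rw [eq_of_heq e]

/-- The 2-category presented by a 3-polygraph `F`: the free 2-category on the underlying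
2-polygraph, in which two 2-cells are identified when they are related by the equivalence
relation generated by rewriting. -/
def presented (F : ThreePolygraph.{w} V) : PathTwoCat.{max u v w} V where
  Cell {a b} f g := Quot (F.Step (c := a) (d := b) (h := f) (k := g))
  id f := Quot.mk _ (F.free.id f)
  vcomp := Quot.map₂ F.free.vcomp (fun γ _ _ s => s.vcomp_left γ) (fun _ _ γ s => s.vcomp_right γ)
  hcomp := Quot.map₂ F.free.hcomp (fun γ _ _ s => s.hcomp_left γ) (fun _ _ γ s => s.hcomp_right γ)
  id_vcomp := by rintro _ _ _ _ ⟨s⟩; exact congrArg (Quot.mk _) (F.free.id_vcomp s)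
  vcomp_id := by rintro _ _ _ _ ⟨s⟩; exact congrArg (Quot.mk _) (F.free.vcomp_id s)
  vcomp_assoc := by
    rintro _ _ _ _ _ _ ⟨s⟩ ⟨t⟩ ⟨r⟩; exact congrArg (Quot.mk _) (F.free.vcomp_assoc s t r)
  hcomp_ids f g := congrArg (Quot.mk _) (F.free.hcomp_ids f g)
  interchange := by
    rintro _ _ _ _ _ _ _ _ _ ⟨s⟩ ⟨s'⟩ ⟨t⟩ ⟨t'⟩
    exact congrArg (Quot.mk _) (F.free.interchange s s' t t')
  hcomp_assoc := by
    rintro _ _ _ _ _ _ _ _ _ _ ⟨s⟩ ⟨t⟩ ⟨r⟩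
    exact F.mk_heq (Path.comp_assoc _ _ _) (Path.comp_assoc _ _ _) (F.free.hcomp_assoc s t r)
  id_hcomp := by
    rintro _ _ _ _ ⟨s⟩; exact F.mk_heq (Path.nil_comp _) (Path.nil_comp _) (F.free.id_hcomp s)
  hcomp_id := by
    rintro _ _ _ _ ⟨s⟩; exact F.mk_heq (Path.comp_nil _) (Path.comp_nil _) (F.free.hcomp_id s)

end

end ThreePolygraph

/-! ### The 3-polygraph of formal adjoints -/

/-- The 0-generators of the 3-polygraph of formal adjoints: those of the original polygraph. -/
def FormalAdj (V : Type u) : Type u := V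

section

variable {V : Type u} [Quiver.{v} V]

/-- The 1-generators `f^n`, for `f` a 1-generator and `n : ℤ` the winding number: if `f : A → B`,
then `f^n : A → B` for `n` even and `f^n : B → A` for `n` odd. -/
inductive FormalAdj.Arrow : V → V → Type (max u v)
  | even {A B : V} (f : A ⟶ B) (n : ℤ) (hn : Even n) : FormalAdj.Arrow A B
  | odd {A B : V} (f : A ⟶ B) (n : ℤ) (hn : Odd n) : FormalAdj.Arrow B A

instance : Quiver.{max u v} (FormalAdj V) where
  Hom A B := FormalAdj.Arrow (V := V) A B

namespace FormalAdj

/-- `f^n ↦ f^(n-1)`. -/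
def pred {A B : FormalAdj V} : (A ⟶ B) → (B ⟶ A)
  | .even f n hn => .odd f (n - 1) (hn.sub_odd odd_one)
  | .odd f n hn => .even f (n - 1) (hn.sub_odd odd_one)

variable (V) in
/-- `A ↦ A` on 0-generators and `f ↦ f^0` on 1-generators. -/
def zero : V ⥤q FormalAdj V where
  obj A := A
  map f := .even f 0 Even.zero

/-- The 2-generators: `α^0 : f^0 ⇒ g^0` for `α : f ⇒ g` a 2-generator of `E`, and, for every
1-generator `x = f^n : A → B`, a unit `η_x : id_B ⇒ f^(n-1) ⊗ f^n` and a counit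
`ε_x : f^n ⊗ f^(n-1) ⇒ id_A`. -/
inductive Gen₂ (E : TwoPolygraph.{w} V) :
    ∀ {A B : FormalAdj V}, Path A B → Path A B → Type (max u v w)
  | base {A B : V} {f g : Path A B} (α : E.Gen f g) :
      Gen₂ E ((zero V).mapPath f) ((zero V).mapPath g)
  | unit {A B : FormalAdj V} (x : A ⟶ B) :
      Gen₂ E (Path.nil : Path B B) ((pred x).toPath.comp x.toPath)
  | counit {A B : FormalAdj V} (x : A ⟶ B) :
      Gen₂ E (x.toPath.comp (pred x).toPath) (Path.nil : Path A A)

/-- The 2-polygraph underlying `F`. -/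
abbrev twoPolygraph (E : TwoPolygraph.{w} V) : TwoPolygraph.{max u v w} (FormalAdj V) where
  Gen f g := Gen₂ E f g

/-- The unit `η_x`, as a 2-cell. -/
def η (E : TwoPolygraph.{w} V) {A B : FormalAdj V} (x : A ⟶ B) :
    (twoPolygraph E).free.Cell (Path.nil : Path B B) ((pred x).toPath.comp x.toPath) :=
  (twoPolygraph E).of (Gen₂.unit x)

/-- The counit `ε_x`, as a 2-cell. -/
def ε (E : TwoPolygraph.{w} V) {A B : FormalAdj V} (x : A ⟶ B) :
    (twoPolygraph E).free.Cell (x.toPath.comp (pred x).toPath) (Path.nil : Path A A) :=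
  (twoPolygraph E).of (Gen₂.counit x)

/-- The 3-generators, for every 1-generator `x = f^n : A → B`:
`l_x : (f^(n-1) ⊗ ε_x) ∘ (η_x ⊗ f^(n-1)) ⇛ f^(n-1)` and
`r_x : (ε_x ⊗ f^n) ∘ (f^n ⊗ η_x) ⇛ f^n`. -/
inductive Gen₃ (E : TwoPolygraph.{w} V) :
    ∀ {A B : FormalAdj V} {f g : Path A B},
      (twoPolygraph E).free.Cell f g → (twoPolygraph E).free.Cell f g → Type (max u v w)
  | l {A B : FormalAdj V} (x : A ⟶ B) :
      Gen₃ E (f := (pred x).toPath) (g := (pred x).toPath)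
        ((twoPolygraph E).free.vcomp
          ((twoPolygraph E).free.hcomp (η E x) ((twoPolygraph E).free.id (pred x).toPath))
          ((twoPolygraph E).free.hcomp ((twoPolygraph E).free.id (pred x).toPath) (ε E x)))
        ((twoPolygraph E).free.id (pred x).toPath)
  | r {A B : FormalAdj V} (x : A ⟶ B) :
      Gen₃ E (f := x.toPath) (g := x.toPath)
        ((twoPolygraph E).free.vcomp
          ((twoPolygraph E).free.hcomp ((twoPolygraph E).free.id x.toPath) (η E x))
          ((twoPolygraph E).free.hcomp (ε E x) ((twoPolygraph E).free.id x.toPath)))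
        ((twoPolygraph E).free.id x.toPath)

/-- The 3-polygraph `F` presenting the free compact 2-category on `E^*`. -/
abbrev polygraph (E : TwoPolygraph.{w} V) : ThreePolygraph (FormalAdj V) where
  toTwoPolygraph := twoPolygraph E
  Gen₃ α β := Gen₃ E α β

/-- The indicator function of the units and counits. -/
def isUnitOrCounit {E : TwoPolygraph.{w} V} {A B : FormalAdj V} {f g : Path A B} :
    (polygraph E).Gen f g → ℕ
  | Gen₂.base _ => 0
  | Gen₂.unit _ => 1
  | Gen₂.counit _ => 1

/-- The embedding `E^* → F^*` into the underlying 2-category of `F^*`: the identity on 0-cells,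
`f ↦ f^0` on 1-cells, `α ↦ α^0` on 2-cells. -/
def toFree (E : TwoPolygraph.{w} V) :
    StrictPseudofunctor E.free.Obj (polygraph E).free.Obj :=
  TwoPolygraph.lift (zero V) (polygraph E).free fun α => (polygraph E).of (Gen₂.base α)

/-- The embedding of `E^*` into the 2-category presented by `F`: the identity on 0-cells,
`f ↦ f^0` on 1-cells, `α ↦ α^0` on 2-cells. -/
def embedding (E : TwoPolygraph.{w} V) :
    StrictPseudofunctor E.free.Obj (polygraph E).presented.Obj :=
  TwoPolygraph.lift (zero V) (polygraph E).presented fun α =>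
    Quot.mk _ ((polygraph E).of (Gen₂.base α))

/-- The number of occurrences of generators `η_x` and `ε_x` in a 2-cell of `F^*`. -/
def unitCounitCount {E : TwoPolygraph.{w} V} {A B : FormalAdj V} {f g : Path A B}
    (α : (polygraph E).free.Cell f g) : ℕ :=
  TwoPolygraph.weight isUnitOrCounit α

end FormalAdj

end

/-!
A rewriting step removes one unit and one counit, so rewriting terminates. Let `α : f⁰ ⇒ g⁰` be a
normal form and let `N` be minimal such that all the units and counits of `α` belong to 1-generators
of winding number in `(-N, N]`. If `N > 0`, some unit of `α` creates a letter of winding number `N`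
or `-N`. This letter does not occur in `g⁰`, so some counit consumes it. Bounded by `N`, this can
only be the counit paired with that unit, and moving the rest of the 2-cell out of the way exposes a
zigzag, which is a redex. Hence `N = 0`: normal forms are the 2-cells `α⁰`.

Faithfulness is proved for one winding number at a time. Any strict 2-category acts by
precomposition on the copresheaves on its categories `a ⟶ X`, faithfully on 2-cells by the Yoneda
lemma, and every 1-cell acts by a functor with a left and a right adjoint, namely the two Kan
extensions. Let `F_N` be presented by the rules of winding number in `(-N, N]`. In the action of
`F_N`, the Kan extensions interpret the letters of winding number `N + 1` and `-(N + 1)` and satisfy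
the rules added in `F_(N+1)`, so that equality in `F_(N+1)` of 2-cells of `E^*` implies their
equality in `F_N`. The generators which still lack an interpretation are sent to an additional
absorbing 2-cell.
-/

namespace PathTwoCat

variable {V : Type u} [Quiver.{v} V]

/-- A 2-cell bundled with its boundary. Equations between 2-cells whose boundaries agree only
propositionally become plain equalities between such pairs. -/
structure Total (C : PathTwoCat.{w} V) (a b : V) where
  {src : Path a b}
  {tgt : Path a b}
  cell : C.Cell src tgt

namespace Total

variable {C : PathTwoCat.{w} V}

theorem mk_eq_of_heq {a b : V} {f g f' g' : Path a b} (hf : f = f') (hg : g = g')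
    {α : C.Cell f g} {β : C.Cell f' g'} (h : α ≍ β) : (⟨α⟩ : C.Total a b) = ⟨β⟩ := by
  subst hf hg
  rw [eq_of_heq h]

theorem mk_inj {a b : V} {f g : Path a b} {α β : C.Cell f g} :
    (⟨α⟩ : C.Total a b) = ⟨β⟩ ↔ α = β := by
  constructor
  · rintro ⟨⟩; rfl
  · rintro rfl; rfl

theorem mk_castCell {a b : V} {f g f' g' : Path a b} (hf : f = f') (hg : g = g')
    (α : C.Cell f g) : (⟨C.castCell hf hg α⟩ : C.Total a b) = ⟨α⟩ :=
  mk_eq_of_heq hf.symm hg.symm (C.castCell_heq hf hg α)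

variable (C) in
/-- The identity 2-cell of a path. -/
abbrev one {a b : V} (p : Path a b) : C.Total a b := ⟨C.id p⟩

/-- Horizontal composition. -/
def hc {a b c : V} (A : C.Total a b) (B : C.Total b c) : C.Total a c :=
  ⟨C.hcomp A.cell B.cell⟩

open Classical in
/-- Vertical composition, with junk value `A` when `A` and `B` are not composable. -/
noncomputable def vc {a b : V} (A B : C.Total a b) : C.Total a b :=
  if h : B.src = A.tgt then ⟨C.vcomp A.cell (C.castCell h rfl B.cell)⟩ else A

end Total

end PathTwoCat

local infixr:70 " ⊠ " => PathTwoCat.Total.hc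
local infixr:65 " ⬝ " => PathTwoCat.Total.vc

namespace PathTwoCat.Total

variable {V : Type u} [Quiver.{v} V] {C : PathTwoCat.{w} V}

@[simp] theorem hc_src {a b c : V} (A : C.Total a b) (B : C.Total b c) :
    (A ⊠ B).src = A.src.comp B.src := rfl

@[simp] theorem hc_tgt {a b c : V} (A : C.Total a b) (B : C.Total b c) :
    (A ⊠ B).tgt = A.tgt.comp B.tgt := rfl

@[simp] theorem mk_vc_mk {a b : V} {f g h : Path a b} (α : C.Cell f g) (β : C.Cell g h) :
    (⟨α⟩ ⬝ ⟨β⟩ : C.Total a b) = ⟨C.vcomp α β⟩ := by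
  rw [vc, dif_pos rfl]; rfl

@[simp] theorem vc_src {a b : V} (A B : C.Total a b) : (A ⬝ B).src = A.src := by
  rw [vc]; split <;> rfl

@[simp] theorem vc_tgt {a b : V} {A B : C.Total a b} (h : A.tgt = B.src) :
    (A ⬝ B).tgt = B.tgt := by
  rw [vc, dif_pos h.symm]

theorem vc_eq_left {a b : V} {A B : C.Total a b} (h : A.tgt ≠ B.src) : A ⬝ B = A := by
  rw [vc, dif_neg h.symm]

theorem exists_eq_mk {a b : V} (A : C.Total a b) {f : Path a b} (h : A.src = f) :
    ∃ (g : Path a b) (α : C.Cell f g), A = ⟨α⟩ := by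
  subst h; exact ⟨A.tgt, A.cell, rfl⟩

theorem vc_assoc {a b : V} {A B : C.Total a b} (h : A.tgt = B.src) (D : C.Total a b) :
    (A ⬝ B) ⬝ D = A ⬝ B ⬝ D := by
  obtain ⟨α⟩ := A
  obtain ⟨k, β, rfl⟩ := B.exists_eq_mk h.symm
  by_cases h' : k = D.src
  · obtain ⟨_, γ, rfl⟩ := D.exists_eq_mk h'.symm
    simp only [mk_vc_mk, C.vcomp_assoc]
  · rw [mk_vc_mk, vc_eq_left h', vc_eq_left (B := D) h', mk_vc_mk]

@[simp] theorem one_vc {a b : V} (A : C.Total a b) : one C A.src ⬝ A = A :=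
  (mk_vc_mk _ _).trans (congrArg _ (C.id_vcomp _))

@[simp] theorem vc_one {a b : V} (A : C.Total a b) (p : Path a b) : A ⬝ one C p = A := by
  by_cases h : A.tgt = p
  · subst h
    exact (mk_vc_mk _ _).trans (congrArg _ (C.vcomp_id _))
  · exact vc_eq_left h

theorem interchange {a b c : V} {A A' : C.Total a b} {B B' : C.Total b c}
    (h : A.tgt = A'.src) (h' : B.tgt = B'.src) :
    (A ⬝ A') ⊠ (B ⬝ B') = (A ⊠ B) ⬝ (A' ⊠ B') := by
  obtain ⟨α⟩ := A
  obtain ⟨β⟩ := B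
  obtain ⟨_, α', rfl⟩ := A'.exists_eq_mk h.symm
  obtain ⟨_, β', rfl⟩ := B'.exists_eq_mk h'.symm
  rw [mk_vc_mk, mk_vc_mk]
  exact (mk_inj.2 (C.interchange α α' β β')).trans (mk_vc_mk _ _).symm

theorem hc_assoc {a b c d : V} (A : C.Total a b) (B : C.Total b c) (D : C.Total c d) :
    (A ⊠ B) ⊠ D = A ⊠ B ⊠ D :=
  mk_eq_of_heq (Path.comp_assoc _ _ _) (Path.comp_assoc _ _ _) (C.hcomp_assoc _ _ _)

@[simp] theorem one_nil_hc {a b : V} (A : C.Total a b) :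
    one C (Path.nil : Path a a) ⊠ A = A :=
  mk_eq_of_heq (Path.nil_comp _) (Path.nil_comp _) (C.id_hcomp _)

@[simp] theorem hc_one_nil {a b : V} (A : C.Total a b) :
    A ⊠ one C (Path.nil : Path b b) = A :=
  mk_eq_of_heq (Path.comp_nil _) (Path.comp_nil _) (C.hcomp_id _)

theorem one_comp {a b c : V} (p : Path a b) (q : Path b c) :
    one C (p.comp q) = one C p ⊠ one C q :=
  mk_inj.2 (C.hcomp_ids p q).symm

theorem one_hc_vc {a b c : V} (p : Path a b) (B B' : C.Total b c) :
    one C p ⊠ (B ⬝ B') = (one C p ⊠ B) ⬝ (one C p ⊠ B') := by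
  by_cases h : B.tgt = B'.src
  · conv_lhs => rw [← vc_one (one C p) p]
    exact interchange rfl h
  · rw [vc_eq_left h, vc_eq_left fun h' => h (Path.comp_injective_right p h')]

theorem vc_hc_one {a b c : V} (A A' : C.Total a b) (q : Path b c) :
    (A ⬝ A') ⊠ one C q = (A ⊠ one C q) ⬝ (A' ⊠ one C q) := by
  by_cases h : A.tgt = A'.src
  · conv_lhs => rw [← vc_one (one C q) q]
    exact interchange h rfl
  · rw [vc_eq_left h, vc_eq_left fun h' => h (Path.comp_injective_left q h')]

theorem hc_eq_left_vc_right {a b c : V} (A : C.Total a b) (B : C.Total b c) :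
    A ⊠ B = (A ⊠ one C B.src) ⬝ (one C A.tgt ⊠ B) := by
  rw [← interchange rfl rfl, vc_one, one_vc]

theorem hc_eq_right_vc_left {a b c : V} (A : C.Total a b) (B : C.Total b c) :
    A ⊠ B = (one C A.src ⊠ B) ⬝ (A ⊠ one C B.tgt) := by
  rw [← interchange rfl rfl, vc_one, one_vc]

theorem zigzag_left {a b c d : V} {u : Path a c} {y : Path c d} {x : Path d c} {v : Path c b}
    {u' : Path a d} {v' : Path d b} (η : C.Cell Path.nil (y.comp x))
    (ε : C.Cell (x.comp y) Path.nil) (X : C.Cell (u.comp y) u') (Y : C.Cell v (y.comp v')) :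
    (one C u ⊠ ⟨η⟩ ⊠ one C v) ⬝ (⟨X⟩ ⊠ one C x ⊠ ⟨Y⟩) ⬝ (one C u' ⊠ ⟨ε⟩ ⊠ one C v') =
      (one C u ⊠ ⟨Y⟩) ⬝ (one C u ⊠ ((⟨η⟩ ⊠ one C y) ⬝ (one C y ⊠ ⟨ε⟩)) ⊠ one C v') ⬝
        (⟨X⟩ ⊠ one C v') := by
  have split_XY : ⟨X⟩ ⊠ one C x ⊠ ⟨Y⟩ = (one C u ⊠ one C (y.comp x) ⊠ ⟨Y⟩) ⬝
      ((⟨X⟩ ⊠ one C (x.comp y)) ⊠ one C v') := by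
    rw [hc_eq_right_vc_left]
    simp only [hc_tgt, one_comp, hc_assoc]
  have exchange_ηY : (one C u ⊠ ⟨η⟩ ⊠ one C v) ⬝ (one C u ⊠ one C (y.comp x) ⊠ ⟨Y⟩) =
      (one C u ⊠ ⟨Y⟩) ⬝ (one C u ⊠ (⟨η⟩ ⊠ one C y) ⊠ one C v') := by
    rw [← one_hc_vc, ← hc_eq_left_vc_right ⟨η⟩ ⟨Y⟩, hc_eq_right_vc_left ⟨η⟩ ⟨Y⟩, one_hc_vc,
      one_nil_hc, one_comp, hc_assoc]
  have exchange_Xε : ((⟨X⟩ ⊠ one C (x.comp y)) ⊠ one C v') ⬝ (one C u' ⊠ ⟨ε⟩ ⊠ one C v') =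
      (one C u ⊠ (one C y ⊠ ⟨ε⟩) ⊠ one C v') ⬝ (⟨X⟩ ⊠ one C v') := by
    rw [← hc_assoc, ← vc_hc_one, ← hc_eq_left_vc_right ⟨X⟩ ⟨ε⟩, hc_eq_right_vc_left ⟨X⟩ ⟨ε⟩,
      vc_hc_one, hc_one_nil, one_comp]
    simp only [hc_assoc]
  rw [split_XY, vc_assoc, exchange_Xε, ← vc_assoc, exchange_ηY, vc_assoc, vc_hc_one, one_hc_vc,
    vc_assoc]
  all_goals simp

theorem zigzag_right {a b c d : V} {u : Path a c} {y : Path c d} {x : Path d c} {v : Path c b}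
    {u' : Path a d} {v' : Path d b} (η : C.Cell Path.nil (y.comp x))
    (ε : C.Cell (x.comp y) Path.nil) (X : C.Cell u (u'.comp x)) (Y : C.Cell (x.comp v) v') :
    (one C u ⊠ ⟨η⟩ ⊠ one C v) ⬝ (⟨X⟩ ⊠ one C y ⊠ ⟨Y⟩) ⬝ (one C u' ⊠ ⟨ε⟩ ⊠ one C v') =
      (⟨X⟩ ⊠ one C v) ⬝ (one C u' ⊠ ((one C x ⊠ ⟨η⟩) ⬝ (⟨ε⟩ ⊠ one C x)) ⊠ one C v) ⬝
        (one C u' ⊠ ⟨Y⟩) := by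
  have split_XY : ⟨X⟩ ⊠ one C y ⊠ ⟨Y⟩ = ((⟨X⟩ ⊠ one C (y.comp x)) ⊠ one C v) ⬝
      (one C u' ⊠ one C (x.comp y) ⊠ ⟨Y⟩) := by
    rw [hc_eq_left_vc_right]
    simp only [hc_src, one_comp, hc_assoc]
  have exchange_Xη : (one C u ⊠ ⟨η⟩ ⊠ one C v) ⬝ ((⟨X⟩ ⊠ one C (y.comp x)) ⊠ one C v) =
      (⟨X⟩ ⊠ one C v) ⬝ (one C u' ⊠ (one C x ⊠ ⟨η⟩) ⊠ one C v) := by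
    rw [← hc_assoc, ← vc_hc_one, ← hc_eq_right_vc_left ⟨X⟩ ⟨η⟩, hc_eq_left_vc_right ⟨X⟩ ⟨η⟩,
      vc_hc_one, hc_one_nil, one_comp]
    simp only [hc_assoc]
  have exchange_εY : (one C u' ⊠ one C (x.comp y) ⊠ ⟨Y⟩) ⬝ (one C u' ⊠ ⟨ε⟩ ⊠ one C v') =
      (one C u' ⊠ (⟨ε⟩ ⊠ one C x) ⊠ one C v) ⬝ (one C u' ⊠ ⟨Y⟩) := by
    rw [← one_hc_vc, ← hc_eq_right_vc_left ⟨ε⟩ ⟨Y⟩, hc_eq_left_vc_right ⟨ε⟩ ⟨Y⟩, one_hc_vc,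
      one_nil_hc, one_comp, hc_assoc]
  rw [split_XY, vc_assoc, exchange_εY, ← vc_assoc, exchange_Xη, vc_assoc, vc_hc_one, one_hc_vc,
    vc_assoc]
  all_goals simp

end PathTwoCat.Total

/-! ### Composites of slices -/

namespace TwoPolygraph

open PathTwoCat PathTwoCat.Total

variable {V : Type u} [Quiver.{v} V] {E : TwoPolygraph.{w} V}

@[elab_as_elim]
theorem free_induction {motive : ∀ {a b : V} {f g : Path a b}, E.free.Cell f g → Prop}
    (of : ∀ {a b : V} {f g : Path a b} (α : E.Gen f g), motive (E.of α))
    (id : ∀ {a b : V} (f : Path a b), motive (E.free.id f))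
    (vcomp : ∀ {a b : V} {f g h : Path a b} (α : E.free.Cell f g) (β : E.free.Cell g h),
      motive α → motive β → motive (E.free.vcomp α β))
    (hcomp : ∀ {a b c : V} {f f' : Path a b} {g g' : Path b c} (α : E.free.Cell f f')
      (β : E.free.Cell g g'), motive α → motive β → motive (E.free.hcomp α β))
    {a b : V} {f g : Path a b} (β : E.free.Cell f g) : motive β := by
  obtain ⟨t⟩ := β
  induction t with
  | gen α => exact of α
  | id f => exact id f
  | vcomp s t hs ht => exact vcomp _ _ (hs (Quot.mk _ s)) (ht (Quot.mk _ t))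
  | hcomp s t hs ht => exact hcomp _ _ (hs (Quot.mk _ s)) (ht (Quot.mk _ t))

theorem weight_vc (φ : ∀ {a b : V} {f g : Path a b}, E.Gen f g → ℕ) {a b : V}
    {A B : E.free.Total a b} (h : A.tgt = B.src) :
    weight φ (A ⬝ B).cell = weight φ A.cell + weight φ B.cell := by
  obtain ⟨α⟩ := A
  obtain ⟨_, β, rfl⟩ := B.exists_eq_mk h.symm
  rw [mk_vc_mk]
  exact weight_vcomp φ α β

/-- The 2-cell `u ⊗ α ⊗ v`, for a 2-generator `α`. -/
def slice {a b c d : V} (u : Path a c) {f g : Path c d} (α : E.Gen f g) (v : Path d b) :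
    E.free.Total a b :=
  one _ u ⊠ ⟨E.of α⟩ ⊠ one _ v

@[simp] theorem slice_src {a b c d : V} (u : Path a c) {f g : Path c d} (α : E.Gen f g)
    (v : Path d b) : (slice u α v).src = u.comp (f.comp v) := rfl

@[simp] theorem slice_tgt {a b c d : V} (u : Path a c) {f g : Path c d} (α : E.Gen f g)
    (v : Path d b) : (slice u α v).tgt = u.comp (g.comp v) := rfl

theorem weight_slice (φ : ∀ {a b : V} {f g : Path a b}, E.Gen f g → ℕ) {a b c d : V}
    (u : Path a c) {f g : Path c d} (α : E.Gen f g) (v : Path d b) :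
    weight φ (slice u α v).cell = φ α :=
  (Nat.zero_add _).trans (Nat.add_zero _)

theorem le_weight_vc_slice_vc (φ : ∀ {a b : V} {f g : Path a b}, E.Gen f g → ℕ) {a b c d : V}
    {u : Path a c} {f g : Path c d} {α : E.Gen f g} {v : Path d b} {X Y : E.free.Total a b}
    (hX : X.tgt = u.comp (f.comp v)) (hY : u.comp (g.comp v) = Y.src) :
    φ α ≤ weight φ (X ⬝ slice u α v ⬝ Y).cell := by
  rw [weight_vc φ (by simpa using hX), weight_vc φ (by simpa using hY), weight_slice]
  omega

theorem one_hc_slice {a b c d e : V} (p : Path e a) (u : Path a c) {f g : Path c d}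
    (α : E.Gen f g) (v : Path d b) : one _ p ⊠ slice u α v = slice (p.comp u) α v := by
  simp only [slice, one_comp, hc_assoc]

theorem slice_hc_one {a b c d e : V} (u : Path a c) {f g : Path c d} (α : E.Gen f g)
    (v : Path d b) (q : Path b e) : slice u α v ⊠ one _ q = slice u α (v.comp q) := by
  simp only [slice, one_comp, hc_assoc]

/-- The vertical composites of slices. By `SliceComposite.of_total` these are all the 2-cells of the
free 2-category, so that induction on this predicate is induction on a 2-cell from its source. -/
inductive SliceComposite {a b : V} : E.free.Total a b → Prop
  | one (p : Path a b) : SliceComposite (one _ p)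
  | slice_vc {c d : V} (u : Path a c) {f g : Path c d} (α : E.Gen f g) (v : Path d b)
      (R : E.free.Total a b) (hR : u.comp (g.comp v) = R.src) :
      SliceComposite R → SliceComposite (slice u α v ⬝ R)

namespace SliceComposite

theorem vc {a b : V} {A B : E.free.Total a b} (hA : SliceComposite A) (hB : SliceComposite B)
    (h : A.tgt = B.src) : SliceComposite (A ⬝ B) := by
  induction hA with
  | one p =>
    obtain rfl : p = B.src := h
    rwa [one_vc]
  | slice_vc u α v R hR _ ih =>
    rw [vc_tgt hR] at h
    rw [vc_assoc hR]
    exact .slice_vc u α v _ (by simpa using hR) (ih h)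

theorem one_hc {a b c : V} (p : Path a b) {A : E.free.Total b c} (hA : SliceComposite A) :
    SliceComposite (Total.one _ p ⊠ A) := by
  induction hA with
  | one q => rw [← one_comp]; exact .one _
  | slice_vc u α v R hR _ ih =>
    rw [one_hc_vc, one_hc_slice]
    exact .slice_vc _ α v _ (by simp [← hR]) ih

theorem hc_one {a b c : V} {A : E.free.Total a b} (hA : SliceComposite A) (q : Path b c) :
    SliceComposite (A ⊠ Total.one _ q) := by
  induction hA with
  | one p => rw [← one_comp]; exact .one _
  | slice_vc u α v R hR _ ih =>
    rw [vc_hc_one, slice_hc_one]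
    exact .slice_vc u α _ _ (by simp [← hR]) ih

theorem of_total {a b : V} (A : E.free.Total a b) : SliceComposite A := by
  obtain ⟨β⟩ := A
  induction β using free_induction with
  | @of _ _ f g α =>
    have := SliceComposite.slice_vc Path.nil α Path.nil (Total.one _ g) (by simp) (.one g)
    rwa [slice, one_nil_hc, hc_one_nil, vc_one] at this
  | id f => exact .one f
  | vcomp α β hα hβ => rw [← mk_vc_mk]; exact hα.vc hβ rfl
  | @hcomp _ _ _ f f' g g' α β hα hβ =>
    have := (hα.hc_one g).vc (hβ.one_hc f') rfl
    rwa [← hc_eq_left_vc_right ⟨α⟩ ⟨β⟩] at this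

end SliceComposite

theorem comp_eq_comp_toPath_comp {a b c d e : V} {p : Path a e} {q : Path e b} {u : Path a c}
    {x : c ⟶ d} {v : Path d b} (h : p.comp q = u.comp (x.toPath.comp v)) :
    (∃ w, p = u.comp (x.toPath.comp w) ∧ v = w.comp q) ∨
      ∃ w, u = p.comp w ∧ q = w.comp (x.toPath.comp v) := by
  induction q with
  | nil => exact .inl ⟨v, h, rfl⟩
  | cons q y ih =>
    cases v with
    | nil =>
      obtain rfl := Path.obj_eq_of_cons_eq_cons h
      obtain rfl := eq_of_heq (Path.heq_of_cons_eq_cons h)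
      obtain rfl := eq_of_heq (Path.hom_heq_of_cons_eq_cons h)
      exact .inr ⟨q, rfl, rfl⟩
    | cons v z =>
      obtain rfl := Path.obj_eq_of_cons_eq_cons h
      obtain rfl := eq_of_heq (Path.hom_heq_of_cons_eq_cons h)
      obtain ⟨w, rfl, rfl⟩ | ⟨w, rfl, rfl⟩ := ih (eq_of_heq (Path.heq_of_cons_eq_cons h))
      · exact .inl ⟨w, rfl, rfl⟩
      · exact .inr ⟨w, rfl, rfl⟩

/-- The letter `x` of the source `u ⊗ x ⊗ v` of `A` is carried unchanged through `A`. -/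
def Survives {a b c d : V} (u : Path a c) (x : c ⟶ d) (v : Path d b) (A : E.free.Total a b) :
    Prop :=
  ∃ (u' : Path a c) (v' : Path d b) (X : E.free.Cell u u') (Y : E.free.Cell v v'),
    A = ⟨X⟩ ⊠ one _ x.toPath ⊠ ⟨Y⟩

/-- The letter `x` of the source `u ⊗ x ⊗ v` of `A` is carried unchanged until it becomes the
letter `x` of the source `p ⊗ x ⊗ q` of a 2-generator `α`. -/
def Consumed {a b c d : V} (u : Path a c) (x : c ⟶ d) (v : Path d b) (A : E.free.Total a b) :
    Prop :=
  ∃ (e k : V) (u' : Path a e) (v' : Path k b) (p : Path e c) (q : Path d k) (s t : Path e k)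
    (α : E.Gen s t) (X : E.free.Cell u (u'.comp p)) (Y : E.free.Cell v (q.comp v'))
    (R : E.free.Total a b), s = p.comp (x.toPath.comp q) ∧ u'.comp (t.comp v') = R.src ∧
      A = (⟨X⟩ ⊠ one _ x.toPath ⊠ ⟨Y⟩) ⬝ slice u' α v' ⬝ R

theorem survives_or_consumed_vc {a b c d : V} {u u' : Path a c} {x : c ⟶ d} {v v' : Path d b}
    (X : E.free.Cell u u') (Y : E.free.Cell v v') {R : E.free.Total a b}
    (hR : Survives u' x v' R ∨ Consumed u' x v' R) :
    Survives u x v ((⟨X⟩ ⊠ one _ x.toPath ⊠ ⟨Y⟩) ⬝ R) ∨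
      Consumed u x v ((⟨X⟩ ⊠ one _ x.toPath ⊠ ⟨Y⟩) ⬝ R) := by
  have merge : ∀ {u'' v''} (X' : E.free.Cell u' u'') (Y' : E.free.Cell v' v''),
      (⟨X⟩ ⊠ one _ x.toPath ⊠ ⟨Y⟩ : E.free.Total a b) ⬝ (⟨X'⟩ ⊠ one _ x.toPath ⊠ ⟨Y'⟩) =
        ⟨E.free.vcomp X X'⟩ ⊠ one _ x.toPath ⊠ ⟨E.free.vcomp Y Y'⟩ := fun X' Y' => by
    rw [← interchange rfl rfl, ← interchange rfl rfl, vc_one, mk_vc_mk, mk_vc_mk]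
  obtain ⟨u'', v'', X', Y', rfl⟩ | ⟨e, k, u'', v'', p, q, s, t, α, X', Y', R', hs, hR', rfl⟩ := hR
  · exact .inl ⟨u'', v'', _, _, merge X' Y'⟩
  · refine .inr ⟨e, k, u'', v'', p, q, s, t, α, E.free.vcomp X X',
      E.free.vcomp Y Y', R', hs, hR', ?_⟩
    rw [← vc_assoc rfl, merge]

theorem survives_or_consumed {a b c d : V} {A : E.free.Total a b} {u : Path a c} {x : c ⟶ d}
    {v : Path d b} (h : A.src = u.comp (x.toPath.comp v)) :
    Survives u x v A ∨ Consumed u x v A := by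
  have hA := SliceComposite.of_total A
  induction hA generalizing u v with
  | one p =>
    obtain rfl : p = _ := h
    exact .inl ⟨u, v, E.free.id u, E.free.id v, by simp only [one_comp]⟩
  | @slice_vc c' d' u₀ s t α v₀ R hR _ ih =>
    rw [vc_src, slice_src] at h
    obtain ⟨w, rfl, rfl⟩ | ⟨p, rfl, h'⟩ := comp_eq_comp_toPath_comp h
    · rw [← one_hc_slice, ← one_hc_slice]
      exact survives_or_consumed_vc (E.free.id u) (slice w α v₀).cell (ih (by simp [← hR]))
    · obtain ⟨q, rfl, rfl⟩ | ⟨w, rfl, rfl⟩ := comp_eq_comp_toPath_comp h'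
      · refine .inr ⟨_, _, u₀, v₀, p, q, _, t, α, E.free.id _, E.free.id _, R, rfl, hR, ?_⟩
        rw [← one_comp, ← one_comp, ← h]
        simpa using (one_vc (slice u₀ α v₀ ⬝ R)).symm
      · rw [← slice_hc_one, one_comp]
        exact survives_or_consumed_vc (slice u₀ α w).cell (E.free.id v) (ih (by simp [← hR]))

end TwoPolygraph

/-! ### Normal forms -/

namespace ThreePolygraph

open PathTwoCat.Total TwoPolygraph

variable {V : Type u} [Quiver.{v} V] {F : ThreePolygraph.{w} V}

theorem Step.of_gen₃ {a b : V} {f g : Path a b} {α β : F.free.Cell f g} (r : F.Gen₃ α β) :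
    F.Step α β :=
  Step.mk r ⟨(F.adjoin f g).of AdjoinGen.var, rfl⟩

/-- Some rewriting step starts from `A`. -/
def Reducible {a b : V} (A : F.free.Total a b) : Prop :=
  ∃ β, F.Step A.cell β

namespace Reducible

theorem of_gen₃ {a b : V} {f g : Path a b} {α β : F.free.Cell f g} (r : F.Gen₃ α β) :
    Reducible (⟨α⟩ : F.free.Total a b) :=
  ⟨β, .of_gen₃ r⟩

theorem vc_left {a b : V} {A B : F.free.Total a b} (hB : Reducible B) (h : A.tgt = B.src) :
    Reducible (A ⬝ B) := by
  obtain ⟨α⟩ := A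
  obtain ⟨_, β, rfl⟩ := B.exists_eq_mk h.symm
  obtain ⟨β', hβ⟩ := hB
  rw [mk_vc_mk]
  exact ⟨_, hβ.vcomp_left α⟩

theorem vc_right {a b : V} {A : F.free.Total a b} (hA : Reducible A) (B : F.free.Total a b) :
    Reducible (A ⬝ B) := by
  by_cases h : A.tgt = B.src
  · obtain ⟨α⟩ := A
    obtain ⟨_, β, rfl⟩ := B.exists_eq_mk h.symm
    obtain ⟨α', hα⟩ := hA
    rw [mk_vc_mk]
    exact ⟨_, hα.vcomp_right β⟩
  · rwa [vc_eq_left h]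

theorem hc_left {a b c : V} (A : F.free.Total a b) {B : F.free.Total b c} (hB : Reducible B) :
    Reducible (A ⊠ B) :=
  hB.imp' _ fun _ => Step.hcomp_left A.cell

theorem hc_right {a b c : V} {A : F.free.Total a b} (hA : Reducible A) (B : F.free.Total b c) :
    Reducible (A ⊠ B) :=
  hA.imp' _ fun _ h => Step.hcomp_right h B.cell

end Reducible

end ThreePolygraph

namespace FormalAdj

open PathTwoCat PathTwoCat.Total TwoPolygraph ThreePolygraph

variable {V : Type u} [Quiver.{v} V]

/-- The winding number of a 1-generator. -/
def wind {A B : FormalAdj V} : (A ⟶ B) → ℤ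
  | .even _ n _ => n
  | .odd _ n _ => n

theorem wind_pred {A B : FormalAdj V} : ∀ x : A ⟶ B, wind (pred x) = wind x - 1
  | .even .. => rfl
  | .odd .. => rfl

theorem pred_injective {A B : FormalAdj V} :
    Function.Injective (pred : (A ⟶ B) → (B ⟶ A))
  | .even f m hm, .even g n hn, h => by
    injection h with _ _ hfg hmn
    subst hfg
    obtain rfl := sub_left_injective hmn
    rfl
  | .odd f m hm, .odd g n hn, h => by
    injection h with _ _ hfg hmn
    subst hfg
    obtain rfl := sub_left_injective hmn
    rfl
  | .even .., .odd .., h => by injection h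
  | .odd .., .even .., h => by injection h

/-- The letters of the path have winding numbers between `-N` and `N`. -/
def Bounded (N : ℕ) {A : FormalAdj V} : ∀ {B : FormalAdj V}, Path A B → Prop
  | _, .nil => True
  | _, .cons p x => Bounded N p ∧ |wind x| ≤ N

@[simp] theorem bounded_comp {N : ℕ} {A B C : FormalAdj V} {p : Path A B} {q : Path B C} :
    Bounded N (p.comp q) ↔ Bounded N p ∧ Bounded N q := by
  induction q with
  | nil => exact (and_iff_left trivial).symm
  | cons q x ih => rw [Path.comp_cons, Bounded, Bounded, ih, and_assoc]

theorem bounded_toPath {N : ℕ} {A B : FormalAdj V} {x : A ⟶ B} :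
    Bounded N x.toPath ↔ |wind x| ≤ N :=
  and_iff_right trivial

theorem Bounded.mono {A B : FormalAdj V} {p : Path A B} (N : ℕ) (hp : Bounded 0 p) :
    Bounded N p := by
  induction p with
  | nil => trivial
  | cons p x ih => exact ⟨ih hp.1, hp.2.trans (by simp)⟩

theorem bounded_mapPath_zero (N : ℕ) {A B : V} (f : Path A B) :
    Bounded N ((zero V).mapPath f) := by
  induction f with
  | nil => trivial
  | cons f x ih => exact ⟨ih, by simp [zero, wind]⟩

variable {E : TwoPolygraph.{w} V}

/-- The indicator function of the units and counits of the 1-generators `x` which involve a winding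
number, of `x` or of `pred x`, outside of the interval from `-N` to `N`. -/
def outside (N : ℕ) {A B : FormalAdj V} {f g : Path A B} : (polygraph E).Gen f g → ℕ
  | Gen₂.base _ => 0
  | Gen₂.unit x => if -(N : ℤ) < wind x ∧ wind x ≤ N then 0 else 1
  | Gen₂.counit x => if -(N : ℤ) < wind x ∧ wind x ≤ N then 0 else 1

theorem outside_unit_eq_zero {N : ℕ} {A B : FormalAdj V} {x : A ⟶ B} :
    outside (E := E) N (Gen₂.unit x) = 0 ↔ -(N : ℤ) < wind x ∧ wind x ≤ N :=
  ite_eq_left_iff.trans (by simp)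

theorem outside_counit_eq_zero {N : ℕ} {A B : FormalAdj V} {x : A ⟶ B} :
    outside (E := E) N (Gen₂.counit x) = 0 ↔ -(N : ℤ) < wind x ∧ wind x ≤ N :=
  ite_eq_left_iff.trans (by simp)

theorem bounded_pred_and_self {N : ℕ} {A B : FormalAdj V} {x : A ⟶ B} :
    |wind (pred x)| ≤ N ∧ |wind x| ≤ N ↔ -(N : ℤ) < wind x ∧ wind x ≤ N := by
  rw [wind_pred, abs_le, abs_le]
  omega

theorem bounded_of_outside_eq_zero {N : ℕ} {A B : FormalAdj V} {f g : Path A B}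
    {α : (polygraph E).Gen f g} (hα : outside N α = 0) : Bounded N g := by
  cases α with
  | base α => exact bounded_mapPath_zero N _
  | unit x =>
    rw [bounded_comp, bounded_toPath, bounded_toPath, bounded_pred_and_self]
    exact outside_unit_eq_zero.1 hα
  | counit x => trivial

theorem exists_unit_outside {N : ℕ} {A B : FormalAdj V} {S : (polygraph E).free.Total A B}
    (hS : Bounded N S.src) :
    weight (outside N) S.cell = 0 ∨
      ∃ (C D : FormalAdj V) (x : C ⟶ D) (u : Path A D) (v : Path D B)
        (X Y : (polygraph E).free.Total A B), outside (E := E) N (Gen₂.unit x) ≠ 0 ∧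
        X.tgt = u.comp v ∧ u.comp (((pred x).toPath.comp x.toPath).comp v) = Y.src ∧
        S = X ⬝ slice u (Gen₂.unit x) v ⬝ Y := by
  induction SliceComposite.of_total S with
  | one p => exact .inl rfl
  | slice_vc u α v R hR _ ih =>
    rw [vc_src, slice_src, bounded_comp, bounded_comp] at hS
    by_cases hα : outside N α = 0
    · have hR' : Bounded N R.src := by
        rw [← hR, bounded_comp, bounded_comp]
        exact ⟨hS.1, bounded_of_outside_eq_zero hα, hS.2.2⟩
      obtain h | ⟨C, D, x, u', v', X, Y, hx, hX, hY, rfl⟩ := ih hR'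
      · left
        rw [weight_vc _ (by simpa using hR), weight_slice, hα, h]
      · rw [vc_src] at hR
        exact .inr ⟨C, D, x, u', v', slice u α v ⬝ X, Y, hx, by rw [vc_tgt hR, hX], hY,
          (vc_assoc hR _).symm⟩
    · cases α with
      | base α => exact absurd rfl hα
      | unit x =>
        refine .inr ⟨_, _, x, u, v, one _ (u.comp v), R, hα, rfl, hR, ?_⟩
        have := one_vc (slice u (Gen₂.unit (E := E) x) v ⬝ R)
        rw [vc_src, slice_src, Path.nil_comp] at this
        exact this.symm
      | counit x =>
        rw [outside_counit_eq_zero, ← bounded_pred_and_self, ← bounded_toPath, ← bounded_toPath,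
          and_comm, ← bounded_comp] at hα
        exact absurd hS.2.1 hα

theorem reducible_left_zigzag {A B : FormalAdj V} (x : A ⟶ B) :
    Reducible (F := polygraph E) ((⟨η E x⟩ ⊠ one _ (pred x).toPath) ⬝
      (one _ (pred x).toPath ⊠ ⟨ε E x⟩)) :=
  (mk_vc_mk (C := (polygraph E).free) (f := (pred x).toPath) (h := (pred x).toPath) _ _).symm ▸
    Reducible.of_gen₃ (Gen₃.l x)

theorem reducible_right_zigzag {A B : FormalAdj V} (x : A ⟶ B) :
    Reducible (F := polygraph E) ((one _ x.toPath ⊠ ⟨η E x⟩) ⬝ (⟨ε E x⟩ ⊠ one _ x.toPath)) :=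
  (mk_vc_mk (C := (polygraph E).free) (f := x.toPath) (h := x.toPath) _ _).symm ▸
    Reducible.of_gen₃ (Gen₃.r x)

theorem reducible_unit_vc_counit_left {A B C D : FormalAdj V} {x : C ⟶ D} {u : Path A D}
    {v : Path D B} {u' : Path A C} {v' : Path C B}
    (X : (polygraph E).free.Cell (u.comp (pred x).toPath) u')
    (Y : (polygraph E).free.Cell v ((pred x).toPath.comp v')) (R : (polygraph E).free.Total A B) :
    Reducible (slice u (Gen₂.unit x) v ⬝ (⟨X⟩ ⊠ one _ x.toPath ⊠ ⟨Y⟩) ⬝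
      slice u' (Gen₂.counit x) v' ⬝ R) := by
  have h₁ : (⟨X⟩ ⊠ one _ x.toPath ⊠ ⟨Y⟩ : (polygraph E).free.Total A B).tgt =
      (slice u' (Gen₂.counit x) v' : (polygraph E).free.Total A B).src := by
    simp only [hc_tgt, slice_src, Path.comp_assoc]
  have h₂ : (slice u (Gen₂.unit x) v : (polygraph E).free.Total A B).tgt =
      (⟨X⟩ ⊠ one _ x.toPath ⊠ ⟨Y⟩ : (polygraph E).free.Total A B).src := by
    simp only [hc_src, slice_tgt, Path.comp_assoc]
  rw [← vc_assoc h₁, ← vc_assoc (by rwa [vc_src]), slice, slice,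
    zigzag_left (C := (polygraph E).free) ((polygraph E).of (Gen₂.unit x))
      ((polygraph E).of (Gen₂.counit x)) X Y]
  refine ((reducible_left_zigzag x).hc_right _ |>.hc_left _ |>.vc_right _).vc_left ?_ |>.vc_right R
  simp only [vc_src, hc_src, hc_tgt, Path.nil_comp]

theorem reducible_unit_vc_counit_right {A B C D : FormalAdj V} {x : C ⟶ D} {u : Path A D}
    {v : Path D B} {u' : Path A C} {v' : Path C B}
    (X : (polygraph E).free.Cell u (u'.comp x.toPath))
    (Y : (polygraph E).free.Cell (x.toPath.comp v) v') (R : (polygraph E).free.Total A B) :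
    Reducible (slice u (Gen₂.unit x) v ⬝ (⟨X⟩ ⊠ one _ (pred x).toPath ⊠ ⟨Y⟩) ⬝
      slice u' (Gen₂.counit x) v' ⬝ R) := by
  have h₁ : (⟨X⟩ ⊠ one _ (pred x).toPath ⊠ ⟨Y⟩ : (polygraph E).free.Total A B).tgt =
      (slice u' (Gen₂.counit x) v' : (polygraph E).free.Total A B).src := by
    simp only [hc_tgt, slice_src, Path.comp_assoc]
  have h₂ : (slice u (Gen₂.unit x) v : (polygraph E).free.Total A B).tgt =
      (⟨X⟩ ⊠ one _ (pred x).toPath ⊠ ⟨Y⟩ : (polygraph E).free.Total A B).src := by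
    simp only [hc_src, slice_tgt, Path.comp_assoc]
  rw [← vc_assoc h₁, ← vc_assoc (by rwa [vc_src]), slice, slice,
    zigzag_right (C := (polygraph E).free) ((polygraph E).of (Gen₂.unit x))
      ((polygraph E).of (Gen₂.counit x)) X Y]
  refine ((reducible_right_zigzag x).hc_right _ |>.hc_left _ |>.vc_right _).vc_left ?_
    |>.vc_right R
  simp only [vc_src, hc_src, hc_tgt, Path.comp_nil, Path.comp_assoc]

theorem toPath_eq_comp_toPath_comp {W : Type u} [Quiver.{v} W] {a b c d : W} {y : a ⟶ b}
    {p : Path a c} {x : c ⟶ d} {q : Path d b} (h : y.toPath = p.comp (x.toPath.comp q)) :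
    a = c ∧ d = b ∧ y ≍ x ∧ p ≍ (Path.nil : Path a a) ∧ q ≍ (Path.nil : Path b b) := by
  have hl := congrArg Path.length h
  simp only [Path.length_comp, Path.length_toPath] at hl
  cases p with
  | cons => rw [Path.length_cons] at hl; omega
  | nil =>
    cases q with
    | cons => rw [Path.length_cons] at hl; omega
    | nil => cases h; exact ⟨rfl, rfl, .rfl, .rfl, .rfl⟩

theorem abs_wind_le_of_survives {N : ℕ} {A B C D : FormalAdj V} {u : Path A C} {x : C ⟶ D}
    {v : Path D B} {S : (polygraph E).free.Total A B} (h : Survives u x v S)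
    (hS : Bounded N S.tgt) : |wind x| ≤ N := by
  obtain ⟨u', v', X, Y, rfl⟩ := h
  rw [hc_tgt, hc_tgt, bounded_comp, bounded_comp] at hS
  exact bounded_toPath.1 hS.2.1

theorem consumed_by_counit_of_wind_ne_zero {A B C D : FormalAdj V} {u : Path A C} {x : C ⟶ D}
    {v : Path D B} {S : (polygraph E).free.Total A B} (hx : wind x ≠ 0) (h : Consumed u x v S) :
    (∃ (u' : Path A C) (v' : Path C B) (X : (polygraph E).free.Cell u u')
      (Y : (polygraph E).free.Cell v ((pred x).toPath.comp v')) (R : (polygraph E).free.Total A B),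
      u'.comp v' = R.src ∧
      S = (⟨X⟩ ⊠ one _ x.toPath ⊠ ⟨Y⟩) ⬝ slice u' (Gen₂.counit x) v' ⬝ R) ∨
    ∃ (y : D ⟶ C) (u' : Path A D) (v' : Path D B)
      (X : (polygraph E).free.Cell u (u'.comp y.toPath)) (Y : (polygraph E).free.Cell v v')
      (R : (polygraph E).free.Total A B), pred y = x ∧ u'.comp v' = R.src ∧
      S = (⟨X⟩ ⊠ one _ x.toPath ⊠ ⟨Y⟩) ⬝ slice u' (Gen₂.counit y) v' ⬝ R := by
  obtain ⟨e, k, u', v', p, q, s, t, α, X, Y, R, hs, hR, rfl⟩ := h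
  cases α with
  | @base _ _ f g α =>
    have hf := bounded_mapPath_zero 0 f
    rw [hs, bounded_comp, bounded_comp, bounded_toPath] at hf
    exact absurd (abs_nonpos_iff.1 hf.2.1) hx
  | unit y =>
    have hl := congrArg Path.length hs
    simp only [Path.length_nil, Path.length_comp, Path.length_toPath] at hl
    omega
  | counit y =>
    rw [Path.nil_comp] at hR
    obtain ⟨w, hy, rfl⟩ | ⟨w, rfl, hy⟩ := comp_eq_comp_toPath_comp hs
    · obtain ⟨rfl, rfl, hyx, hp, hw⟩ := toPath_eq_comp_toPath_comp hy
      obtain rfl := eq_of_heq hyx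
      obtain rfl := eq_of_heq hp
      obtain rfl := eq_of_heq hw
      exact .inl ⟨u', v', X, Y, R, hR, rfl⟩
    · obtain ⟨rfl, rfl, hyx, hw, hq⟩ := toPath_eq_comp_toPath_comp hy
      obtain rfl := eq_of_heq hyx
      obtain rfl := eq_of_heq hw
      obtain rfl := eq_of_heq hq
      revert Y
      rw [Path.nil_comp]
      intro Y
      exact .inr ⟨y, u', v', X, Y, R, rfl, hR, rfl⟩

theorem reducible_unit_vc_of_wind_eq_top {N : ℕ} {A B C D : FormalAdj V} {x : C ⟶ D}
    {u : Path A D} {v : Path D B} {S : (polygraph E).free.Total A B} (hx : wind x = N + 1)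
    (hsrc : u.comp (((pred x).toPath.comp x.toPath).comp v) = S.src) (htgt : Bounded N S.tgt)
    (hS : weight (outside (N + 1)) S.cell = 0) : Reducible (slice u (Gen₂.unit x) v ⬝ S) := by
  obtain h | h := survives_or_consumed (u := u.comp (pred x).toPath) (x := x) (v := v) (A := S)
    (by rw [← hsrc, Path.comp_assoc, Path.comp_assoc])
  · have := (abs_le.1 (abs_wind_le_of_survives h htgt)).2
    omega
  · obtain ⟨u', v', X, Y, R, -, rfl⟩ | ⟨y, u', v', X, Y, R, rfl, hR, rfl⟩ :=
      consumed_by_counit_of_wind_ne_zero (by omega) h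
    · exact reducible_unit_vc_counit_left X Y R
    · have := Nat.le_zero.1 <| hS ▸ le_weight_vc_slice_vc (outside (N + 1))
        (α := Gen₂.counit (E := E) y) (by simp only [hc_tgt, Path.comp_assoc])
        (by rwa [Path.nil_comp])
      rw [outside_counit_eq_zero] at this
      rw [wind_pred] at hx
      push_cast at this
      omega

theorem reducible_unit_vc_of_wind_eq_bot {N : ℕ} {A B C D : FormalAdj V} {x : C ⟶ D}
    {u : Path A D} {v : Path D B} {S : (polygraph E).free.Total A B} (hx : wind x = -N)
    (hsrc : u.comp (((pred x).toPath.comp x.toPath).comp v) = S.src) (htgt : Bounded N S.tgt)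
    (hS : weight (outside (N + 1)) S.cell = 0) : Reducible (slice u (Gen₂.unit x) v ⬝ S) := by
  have hx' : wind (pred x) = -N - 1 := by rw [wind_pred, hx]
  obtain h | h := survives_or_consumed (u := u) (x := pred x) (v := x.toPath.comp v) (A := S)
    (by rw [← hsrc, Path.comp_assoc])
  · have := (abs_le.1 (abs_wind_le_of_survives h htgt)).1
    omega
  · obtain ⟨u', v', X, Y, R, hR, rfl⟩ | ⟨y, u', v', X, Y, R, hy, -, rfl⟩ :=
      consumed_by_counit_of_wind_ne_zero (by omega) h
    · have := Nat.le_zero.1 <| hS ▸ le_weight_vc_slice_vc (outside (N + 1))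
        (α := Gen₂.counit (E := E) (pred x)) (by simp only [hc_tgt, Path.comp_assoc])
        (by rwa [Path.nil_comp])
      rw [outside_counit_eq_zero] at this
      push_cast at this
      omega
    · obtain rfl := pred_injective hy
      exact reducible_unit_vc_counit_right X Y R

theorem weight_outside_eq_zero_or_reducible_of_succ {N : ℕ} {A B : FormalAdj V}
    {S : (polygraph E).free.Total A B} (hsrc : Bounded N S.src) (htgt : Bounded N S.tgt)
    (hS : weight (outside (N + 1)) S.cell = 0) :
    weight (outside N) S.cell = 0 ∨ Reducible S := by
  refine (exists_unit_outside hsrc).imp_right ?_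
  rintro ⟨C, D, x, u, v, X, Y, hx, hX, hY, rfl⟩
  have hx' := Nat.le_zero.1 <| hS ▸ le_weight_vc_slice_vc (outside (N + 1)) (u := u) (v := v)
    (α := Gen₂.unit (E := E) x) (by rwa [Path.nil_comp]) hY
  have hXY : X.tgt = (slice u (Gen₂.unit (E := E) x) v ⬝ Y).src := by
    rwa [vc_src, slice_src, Path.nil_comp]
  rw [Ne, outside_unit_eq_zero] at hx
  rw [outside_unit_eq_zero] at hx'
  push_cast at hx'
  rw [vc_tgt hXY, vc_tgt hY] at htgt
  rw [weight_vc _ hXY, weight_vc _ hY, add_eq_zero, add_eq_zero] at hS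
  obtain h | h : wind x = N + 1 ∨ wind x = -N := by omega
  · exact (reducible_unit_vc_of_wind_eq_top h hY htgt hS.2.2).vc_left hXY
  · exact (reducible_unit_vc_of_wind_eq_bot h hY htgt hS.2.2).vc_left hXY

theorem outside_eq_isUnitOrCounit_of_zero {A B : FormalAdj V} {f g : Path A B}
    (α : (polygraph E).Gen f g) : outside 0 α = isUnitOrCounit α := by
  cases α with
  | base => rfl
  | unit x => exact if_neg (by push_cast; omega)
  | counit x => exact if_neg (by push_cast; omega)

theorem eventually_weight_outside_eq_zero {A B : FormalAdj V} {f g : Path A B}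
    (β : (polygraph E).free.Cell f g) : ∀ᶠ N in Filter.atTop, weight (outside N) β = 0 := by
  induction β using free_induction with
  | of α =>
    obtain ⟨n, hn⟩ : ∃ n : ℕ, ∀ N : ℕ, n ≤ N → outside N α = 0 := by
      cases α with
      | base => exact ⟨0, fun _ _ => rfl⟩
      | unit x => exact ⟨(wind x).natAbs + 1, fun N _ => outside_unit_eq_zero.2 (by omega)⟩
      | counit x => exact ⟨(wind x).natAbs + 1, fun N _ => outside_counit_eq_zero.2 (by omega)⟩
    exact Filter.eventually_atTop.2 ⟨n, hn⟩
  | id f => exact .of_forall fun _ => rfl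
  | vcomp α β hα hβ =>
    filter_upwards [hα, hβ] with N hα hβ
    rw [weight_vcomp, hα, hβ]
  | hcomp α β hα hβ =>
    filter_upwards [hα, hβ] with N hα hβ
    rw [weight_hcomp, hα, hβ]

theorem unitCounitCount_eq_zero {A B : FormalAdj V} {f g : Path A B}
    (hf : Bounded 0 f) (hg : Bounded 0 g) {α : (polygraph E).free.Cell f g}
    (hα : (polygraph E).IsNormalForm α) : unitCounitCount α = 0 := by
  obtain ⟨N, hN⟩ := (eventually_weight_outside_eq_zero α).exists
  induction N with
  | zero =>
    rw [unitCounitCount, ← hN]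
    congr 1
    funext
    exact (outside_eq_isUnitOrCounit_of_zero _).symm
  | succ N ih =>
    obtain h | ⟨β, h⟩ := weight_outside_eq_zero_or_reducible_of_succ (S := ⟨α⟩) (hf.mono N)
      (hg.mono N) hN
    · exact ih h
    · exact absurd h (hα β)

end FormalAdj

/-! ### Fullness -/

namespace TwoPolygraph

variable {V : Type u} [Quiver.{v} V] {E : TwoPolygraph.{w} V}

/-- The weights on `E[f ⇒ g]` which agree with `φ` on `E` and vanish on the metavariable. -/
def oldWeight (φ : ∀ {a b : V} {f g : Path a b}, E.Gen f g → ℕ) {a b : V} {f g : Path a b}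
    {c d : V} {h k : Path c d} : (E.adjoin f g).Gen h k → ℕ
  | AdjoinGen.old α => φ α
  | AdjoinGen.var => 0

theorem weight_eval_substVar (φ : ∀ {a b : V} {f g : Path a b}, E.Gen f g → ℕ) {a b : V}
    {f g : Path a b} (α : E.free.Cell f g) {c d : V} {h k : Path c d}
    (κ : (E.adjoin f g).free.Cell h k) :
    weight φ (eval E.free (substVar α) κ) =
      weight (oldWeight φ) κ + weight isVar κ * weight φ α := by
  induction κ using free_induction with
  | of β =>
    cases β with
    | old β => exact (by simp : φ β = φ β + 0 * weight φ α)
    | var => exact (by simp : weight φ α = 0 + 1 * weight φ α)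
  | id => exact (by simp : 0 = 0 + 0 * weight φ α)
  | vcomp κ κ' h h' =>
    rw [eval_vcomp, weight_vcomp, weight_vcomp, weight_vcomp, h, h']
    ring
  | hcomp κ κ' h h' =>
    rw [eval_hcomp, weight_hcomp, weight_hcomp, weight_hcomp, h, h']
    ring

theorem Context.weight_apply (φ : ∀ {a b : V} {f g : Path a b}, E.Gen f g → ℕ) {a b : V}
    {f g : Path a b} {c d : V} {h k : Path c d} (K : E.Context f g h k) (α : E.free.Cell f g) :
    weight φ (K.apply α) = weight (oldWeight φ) K.cell + weight φ α := by
  rw [apply, weight_eval_substVar, K.weight_var, one_mul]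

end TwoPolygraph

namespace ThreePolygraph

open PathTwoCat TwoPolygraph

variable {V : Type u} [Quiver.{v} V] {W : Type u'} [Quiver.{v'} W] (F : ThreePolygraph.{w'} W)

theorem castCell_mk {a b : W} {f g f' g' : Path a b} (hf : f = f') (hg : g = g')
    (α : F.free.Cell f g) :
    F.presented.castCell hf hg (Quot.mk _ α) = Quot.mk _ (F.free.castCell hf hg α) := by
  subst hf hg; rfl

theorem eval_comap_presented {E : TwoPolygraph.{w} V} (φ : V ⥤q W)
    (σ : ∀ {a b : V} {f g : Path a b}, E.Gen f g → F.free.Cell (φ.mapPath f) (φ.mapPath g))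
    {a b : V} {f g : Path a b} (α : E.free.Cell f g) :
    eval (F.presented.comap φ) (fun β => Quot.mk _ (σ β)) α =
      Quot.mk _ (eval (F.free.comap φ) σ α) := by
  induction α using free_induction with
  | of α => rfl
  | id f => rfl
  | vcomp α β hα hβ =>
    exact (eval_vcomp (F.presented.comap φ) _ α β).trans
      ((congrArg₂ (F.presented.comap φ).vcomp hα hβ).trans
        (congrArg (Quot.mk _) (eval_vcomp (F.free.comap φ) σ α β)).symm)
  | hcomp α β hα hβ =>
    exact (eval_hcomp (F.presented.comap φ) _ α β).trans
      ((congrArg₂ (F.presented.comap φ).hcomp hα hβ).trans ((F.castCell_mk _ _ _).trans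
        (congrArg (Quot.mk _) (eval_hcomp (F.free.comap φ) σ α β)).symm))

end ThreePolygraph

namespace FormalAdj

open PathTwoCat PathTwoCat.Total TwoPolygraph

variable {V : Type u} [Quiver.{v} V]

theorem mapPath_zero_injective {A B : V} :
    Function.Injective ((zero V).mapPath : Path A B → Path ((zero V).obj A) ((zero V).obj B)) := by
  intro f g h
  induction f with
  | nil =>
    cases g with
    | nil => rfl
    | cons g y => cases congrArg Path.length h
  | cons f x ih =>
    cases g with
    | nil => cases congrArg Path.length h
    | cons g y =>
      obtain rfl := Path.obj_eq_of_cons_eq_cons h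
      obtain rfl := ih (eq_of_heq (Path.heq_of_cons_eq_cons h))
      injection eq_of_heq (Path.hom_heq_of_cons_eq_cons h) with _ _ hxy
      subst hxy; rfl

theorem exists_of_comp_eq_mapPath_zero {A B C : V} {p : @Path (FormalAdj V) _ A B}
    {q : @Path (FormalAdj V) _ B C} {f : Path A C} (h : p.comp q = (zero V).mapPath f) :
    ∃ (f₁ : Path A B) (f₂ : Path B C), f = f₁.comp f₂ ∧ p = (zero V).mapPath f₁ ∧
      q = (zero V).mapPath f₂ := by
  induction q with
  | nil => exact ⟨f, Path.nil, rfl, h, rfl⟩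
  | cons q x ih =>
    cases f with
    | nil => cases congrArg Path.length h
    | cons f y =>
      obtain rfl := Path.obj_eq_of_cons_eq_cons h
      obtain rfl := eq_of_heq (Path.hom_heq_of_cons_eq_cons h)
      obtain ⟨f₁, f₂, rfl, rfl, rfl⟩ := ih (eq_of_heq (Path.heq_of_cons_eq_cons h))
      exact ⟨f₁, f₂.cons y, rfl, rfl, rfl⟩

variable {E : TwoPolygraph.{w} V}

/-- The 2-cell `α⁰`, with its boundary. -/
def zeroTotal {A B : V} {f g : Path A B} (α : E.free.Cell f g) : (polygraph E).free.Total A B :=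
  ⟨eval ((polygraph E).free.comap (zero V)) (fun β => (polygraph E).of (Gen₂.base β)) α⟩

theorem zeroTotal_vcomp {A B : V} {f g h : Path A B} (α : E.free.Cell f g)
    (β : E.free.Cell g h) : zeroTotal (E.free.vcomp α β) = zeroTotal α ⬝ zeroTotal β := by
  refine (congrArg (mk (C := (polygraph E).free))
    (eval_vcomp ((polygraph E).free.comap (zero V)) _ α β)).trans ?_
  exact (mk_vc_mk (C := (polygraph E).free) _ _).symm

theorem zeroTotal_hcomp {A B C : V} {f f' : Path A B} {g g' : Path B C} (α : E.free.Cell f f')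
    (β : E.free.Cell g g') : zeroTotal (E.free.hcomp α β) = zeroTotal α ⊠ zeroTotal β := by
  refine (congrArg (mk (C := (polygraph E).free))
    (eval_hcomp ((polygraph E).free.comap (zero V)) _ α β)).trans ?_
  exact mk_castCell (C := (polygraph E).free) _ _ _

theorem exists_zeroTotal_eq {A B : FormalAdj V} {p q : Path A B} (γ : (polygraph E).free.Cell p q)
    (hγ : unitCounitCount γ = 0) {f : @Path V _ A B} (hf : p = (zero V).mapPath f) :
    ∃ (g : @Path V _ A B) (α : E.free.Cell f g), ⟨γ⟩ = zeroTotal α := by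
  induction γ using free_induction with
  | of α =>
    cases α with
    | base α =>
      obtain rfl := mapPath_zero_injective hf
      exact ⟨_, E.of α, rfl⟩
    | unit x => cases hγ
    | counit x => cases hγ
  | id p =>
    subst hf
    exact ⟨f, E.free.id f, rfl⟩
  | vcomp γ δ ihγ ihδ =>
    rw [unitCounitCount, weight_vcomp, add_eq_zero] at hγ
    obtain ⟨g, α, hα⟩ := ihγ hγ.1 hf
    obtain ⟨k, β, hβ⟩ := ihδ hγ.2 (congrArg Total.tgt hα)
    exact ⟨k, E.free.vcomp α β, (mk_vc_mk γ δ).symm.trans <|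
      (congrArg₂ vc hα hβ).trans (zeroTotal_vcomp α β).symm⟩
  | hcomp γ δ ihγ ihδ =>
    rw [unitCounitCount, weight_hcomp, add_eq_zero] at hγ
    obtain ⟨f₁, f₂, rfl, hf₁, hf₂⟩ := exists_of_comp_eq_mapPath_zero (V := V) hf
    obtain ⟨g, α, hα⟩ := ihγ hγ.1 hf₁
    obtain ⟨k, β, hβ⟩ := ihδ hγ.2 hf₂
    exact ⟨g.comp k, E.free.hcomp α β, (congrArg₂ hc hα hβ).trans (zeroTotal_hcomp α β).symm⟩

theorem exists_map₂_toFree_eq {A B : E.free.Obj} {f g : A ⟶ B}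
    (α : (toFree E).map f ⟶ (toFree E).map g) (h : unitCounitCount α = 0) :
    ∃ β : f ⟶ g, (toFree E).map₂ β = α := by
  obtain ⟨g', β, hβ⟩ := exists_zeroTotal_eq α h rfl
  obtain rfl := mapPath_zero_injective (congrArg Total.tgt hβ)
  exact ⟨β, (mk_inj.1 hβ).symm⟩

theorem weight_zeroTotal {A B : V} {f g : Path A B} (α : E.free.Cell f g) :
    weight isUnitOrCounit (zeroTotal α).cell = 0 := by
  induction α using free_induction with
  | of α => rfl
  | id f => rfl
  | vcomp α β hα hβ =>
    rw [zeroTotal_vcomp]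
    exact (weight_vc (A := zeroTotal α) (B := zeroTotal β) _ rfl).trans
      (congrArg₂ (· + ·) hα hβ)
  | hcomp α β hα hβ =>
    rw [zeroTotal_hcomp]
    exact (weight_hcomp _ _ _).trans (congrArg₂ (· + ·) hα hβ)

theorem unitCounitCount_eq_add_two_of_step {A B : FormalAdj V} {f g : Path A B}
    {α β : (polygraph E).free.Cell f g} (h : (polygraph E).Step α β) :
    unitCounitCount α = unitCounitCount β + 2 := by
  obtain ⟨r, K⟩ := h
  rw [unitCounitCount, unitCounitCount, K.weight_apply, K.weight_apply, add_assoc]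
  congr 1
  cases r <;> rfl

theorem isNormalForm_iff {A B : E.free.Obj} {f g : A ⟶ B}
    (α : (toFree E).map f ⟶ (toFree E).map g) :
    (polygraph E).IsNormalForm α ↔ unitCounitCount α = 0 := by
  refine ⟨unitCounitCount_eq_zero (bounded_mapPath_zero 0 _) (bounded_mapPath_zero 0 _),
    fun h β hβ => ?_⟩
  have := unitCounitCount_eq_add_two_of_step hβ
  omega

theorem embedding_map₂ {A B : E.free.Obj} {f g : A ⟶ B} (α : f ⟶ g) :
    (embedding E).map₂ α = Quot.mk _ ((toFree E).map₂ α) :=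
  (polygraph E).eval_comap_presented (zero V) _ α

theorem exists_embedding_map₂_eq {A B : E.free.Obj} {f g : A ⟶ B}
    (α : (toFree E).map f ⟶ (toFree E).map g) :
    ∃ β : f ⟶ g, (embedding E).map₂ β = Quot.mk _ α := by
  induction hn : unitCounitCount α using Nat.strong_induction_on generalizing α with
  | _ n ih =>
    by_cases h : (polygraph E).IsNormalForm α
    · obtain ⟨β, rfl⟩ := exists_map₂_toFree_eq α ((isNormalForm_iff α).1 h)
      exact ⟨β, embedding_map₂ β⟩
    · simp only [ThreePolygraph.IsNormalForm, not_forall, not_not] at h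
      obtain ⟨β, hβ⟩ := h
      have := unitCounitCount_eq_add_two_of_step hβ
      obtain ⟨γ, hγ⟩ := ih (unitCounitCount β) (by omega) β rfl
      exact ⟨γ, hγ.trans (Quot.sound hβ).symm⟩

end FormalAdj

/-! ### Faithfulness -/

namespace PathTwoCat

open Bicategory

section

theorem eqToHom_conj_heq {C : Type u} [Category.{v} C] {X Y X' Y' : C} (hX : X' = X)
    (hY : Y = Y') (f : X ⟶ Y) : eqToHom hX ≫ f ≫ eqToHom hY ≍ f :=
  (conj_eqToHom_iff_heq' _ _ hX hY).1 rfl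

theorem id_heq_id {C : Type u} [Category.{v} C] {X Y : C} (h : X = Y) : 𝟙 X ≍ 𝟙 Y := by
  subst h; rfl

variable {B : Type u} [Bicategory.{w, v} B]

/-- The horizontal composite of two 2-morphisms of a bicategory. -/
abbrev whiskerComp {a b c : B} {f f' : a ⟶ b} {g g' : b ⟶ c} (α : f ⟶ f') (β : g ⟶ g') :
    f ≫ g ⟶ f' ≫ g' :=
  f ◁ β ≫ α ▷ g'

theorem whiskerComp_heq {a b c : B} {f f' k k' : a ⟶ b} {g g' l l' : b ⟶ c} (hf : f = k)
    (hf' : f' = k') (hg : g = l) (hg' : g' = l') {α : f ⟶ f'} {β : g ⟶ g'} {γ : k ⟶ k'}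
    {δ : l ⟶ l'} (hα : α ≍ γ) (hβ : β ≍ δ) : whiskerComp α β ≍ whiskerComp γ δ := by
  subst hf hf' hg hg'
  rw [eq_of_heq hα, eq_of_heq hβ]

variable [Strict B]

theorem whiskerComp_assoc_heq {a b c d : B} {f f' : a ⟶ b} {g g' : b ⟶ c} {h h' : c ⟶ d}
    (α : f ⟶ f') (β : g ⟶ g') (γ : h ⟶ h') :
    whiskerComp (whiskerComp α β) γ ≍ whiskerComp α (whiskerComp β γ) := by
  have : whiskerComp (whiskerComp α β) γ =
      (α_ f g h).hom ≫ whiskerComp α (whiskerComp β γ) ≫ (α_ f' g' h').inv := by simp [whiskerComp]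
  rw [this, Strict.associator_eqToIso, Strict.associator_eqToIso, eqToIso.hom, eqToIso.inv]
  exact eqToHom_conj_heq _ _ _

theorem whiskerComp_id_left_heq {a b : B} {f f' : a ⟶ b} (α : f ⟶ f') :
    whiskerComp (𝟙 (𝟙 a)) α ≍ α := by
  have : whiskerComp (𝟙 (𝟙 a)) α = (λ_ f).hom ≫ α ≫ (λ_ f').inv := by simp [whiskerComp]
  rw [this, Strict.leftUnitor_eqToIso, Strict.leftUnitor_eqToIso, eqToIso.hom, eqToIso.inv]
  exact eqToHom_conj_heq _ _ _

theorem whiskerComp_id_right_heq {a b : B} {f f' : a ⟶ b} (α : f ⟶ f') :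
    whiskerComp α (𝟙 (𝟙 b)) ≍ α := by
  have : whiskerComp α (𝟙 (𝟙 b)) = (ρ_ f).hom ≫ α ≫ (ρ_ f').inv := by simp [whiskerComp]
  rw [this, Strict.rightUnitor_eqToIso, Strict.rightUnitor_eqToIso, eqToIso.hom, eqToIso.inv]
  exact eqToHom_conj_heq _ _ _

/-- The 2-category over the paths of `V` obtained from a strict 2-category `B` and a functor `Φ`
from the paths of `V` to the 1-cells of `B`: the 2-cells `f ⇒ g` are the 2-cells `Φ f ⇒ Φ g`. -/
def pullback {V : Type u'} [Quiver.{v'} V] (Φ : Paths V ⥤ B) : PathTwoCat.{w} V where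
  Cell f g := Φ.map f ⟶ Φ.map g
  id f := 𝟙 (Φ.map f)
  vcomp α β := α ≫ β
  hcomp {_ _ _ f f' g g'} α β :=
    eqToHom (Φ.map_comp f g) ≫ whiskerComp α β ≫ eqToHom (Φ.map_comp f' g').symm
  id_vcomp α := Category.id_comp α
  vcomp_id α := Category.comp_id α
  vcomp_assoc α β γ := Category.assoc α β γ
  hcomp_ids f g := by simp [whiskerComp]
  interchange α α' β β' := by simp [whisker_exchange_assoc]
  hcomp_assoc α β γ := by
    refine (eqToHom_conj_heq _ _ _).trans (HEq.trans ?_ (eqToHom_conj_heq _ _ _).symm)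
    refine (whiskerComp_heq (Φ.map_comp _ _) (Φ.map_comp _ _) rfl rfl
      (eqToHom_conj_heq _ _ _) HEq.rfl).trans ((whiskerComp_assoc_heq _ _ _).trans ?_)
    exact (whiskerComp_heq rfl rfl (Φ.map_comp _ _) (Φ.map_comp _ _) HEq.rfl
      (eqToHom_conj_heq _ _ _)).symm
  id_hcomp α := (eqToHom_conj_heq _ _ _).trans ((whiskerComp_heq (Φ.map_id _) (Φ.map_id _) rfl rfl
    (id_heq_id (Φ.map_id _)) HEq.rfl).trans (whiskerComp_id_left_heq α))
  hcomp_id α := (eqToHom_conj_heq _ _ _).trans ((whiskerComp_heq rfl rfl (Φ.map_id _) (Φ.map_id _)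
    HEq.rfl (id_heq_id (Φ.map_id _))).trans (whiskerComp_id_right_heq α))

end

section

variable {V : Type u} [Quiver.{v} V] (C : PathTwoCat.{w} V)

theorem some_heq {a b : V} {p q p' q' : Path a b} (hp : p = p') (hq : q = q')
    {α : C.Cell p q} {β : C.Cell p' q'} (h : α ≍ β) :
    (some α : Option (C.Cell p q)) ≍ some β := by
  subst hp hq
  rw [eq_of_heq h]

theorem none_heq {a b : V} {p q p' q' : Path a b} (hp : p = p') (hq : q = q') :
    (none : Option (C.Cell p q)) ≍ (none : Option (C.Cell p' q')) := by
  subst hp hq; rfl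

/-- The 2-category with one more 2-cell between any two parallel 1-cells, absorbing for both
compositions. It interprets the generators which have no counterpart in `C`. -/
def withBot : PathTwoCat.{w} V where
  Cell f g := Option (C.Cell f g)
  id f := some (C.id f)
  vcomp := Option.map₂ C.vcomp
  hcomp := Option.map₂ C.hcomp
  id_vcomp α := by cases α <;> simp [C.id_vcomp]
  vcomp_id α := by cases α <;> simp [C.vcomp_id]
  vcomp_assoc α β γ := by cases α <;> cases β <;> cases γ <;> simp [C.vcomp_assoc]
  hcomp_ids f g := congrArg some (C.hcomp_ids f g)
  interchange α α' β β' := by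
    cases α <;> cases α' <;> cases β <;> cases β' <;> simp [C.interchange]
  hcomp_assoc α β γ := by
    cases α <;> cases β <;> cases γ <;>
      first
      | exact C.some_heq (Path.comp_assoc _ _ _) (Path.comp_assoc _ _ _) (C.hcomp_assoc _ _ _)
      | exact C.none_heq (Path.comp_assoc _ _ _) (Path.comp_assoc _ _ _)
  id_hcomp α := by
    cases α
    · exact C.none_heq (Path.nil_comp _) (Path.nil_comp _)
    · exact C.some_heq (Path.nil_comp _) (Path.nil_comp _) (C.id_hcomp _)
  hcomp_id α := by
    cases α
    · exact C.none_heq (Path.comp_nil _) (Path.comp_nil _)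
    · exact C.some_heq (Path.comp_nil _) (Path.comp_nil _) (C.hcomp_id _)

end

end PathTwoCat

namespace TwoPolygraph

open PathTwoCat

variable {V : Type u} [Quiver.{v} V] {E : TwoPolygraph.{w} V} (C : PathTwoCat.{w'} V)
  (σ : ∀ {a b : V} {f g : Path a b}, E.Gen f g → C.Cell f g)

theorem eval_castCell_heq {a b : V} {f g f' g' : Path a b} (hf : f = f') (hg : g = g')
    (α : E.free.Cell f g) : eval C σ (E.free.castCell hf hg α) ≍ eval C σ α := by
  subst hf hg; rfl

/-- The interpretation of the generators of `E[f ⇒ g]` which extends an interpretation `σ` of those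
of `E` by sending the metavariable to `α`. -/
def evalVar {a b : V} {f g : Path a b} (α : C.Cell f g) {c d : V} {h k : Path c d} :
    (E.adjoin f g).Gen h k → C.Cell h k
  | .old β => σ β
  | .var => α

theorem eval_eval_substVar {a b : V} {f g : Path a b} (α : E.free.Cell f g) {c d : V}
    {h k : Path c d} (β : (E.adjoin f g).free.Cell h k) :
    eval C σ (eval E.free (substVar α) β) = eval C (evalVar C σ (eval C σ α)) β := by
  induction β using free_induction with
  | of β => cases β <;> rfl
  | id f => rfl
  | vcomp β γ hβ hγ => rw [eval_vcomp, eval_vcomp, eval_vcomp, hβ, hγ]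
  | hcomp β γ hβ hγ => rw [eval_hcomp, eval_hcomp, eval_hcomp, hβ, hγ]

theorem Context.eval_apply_congr {a b : V} {f g : Path a b} {c d : V} {h k : Path c d}
    (K : E.Context f g h k) {α β : E.free.Cell f g} (e : eval C σ α = eval C σ β) :
    eval C σ (K.apply α) = eval C σ (K.apply β) := by
  rw [Context.apply, Context.apply, eval_eval_substVar, eval_eval_substVar, e]

end TwoPolygraph

namespace PathTwoCat

open Bicategory

section

variable {B : Type u} [Bicategory.{w, v} B] {a b : B} {f : a ⟶ b} {g : b ⟶ a}

theorem leftZigzag_eq (i : 𝟙 a ⟶ f ≫ g) (e : g ≫ f ⟶ 𝟙 b) :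
    leftZigzag i e = i ▷ f ≫ (α_ f g f).hom ≫ f ◁ e := by
  simp [leftZigzag, bicategoricalComp]

theorem rightZigzag_eq (i : 𝟙 a ⟶ f ≫ g) (e : g ≫ f ⟶ 𝟙 b) :
    rightZigzag i e = g ◁ i ≫ (α_ g f g).inv ≫ e ▷ g := by
  simp [rightZigzag, bicategoricalComp]

end

section

variable {V : Type u} [Quiver.{v} V] (C : PathTwoCat.{w} V)

theorem hcomp_eq_vcomp {a b c : V} {f f' : Path a b} {g g' : Path b c} (α : C.Cell f f')
    (β : C.Cell g g') :
    C.hcomp α β = C.vcomp (C.hcomp (C.id f) β) (C.hcomp α (C.id g')) := by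
  rw [← C.interchange, C.id_vcomp, C.vcomp_id]

/-- The adjunction between generating 1-cells whose unit and counit are two given 2-cells satisfying
the zigzag equations. -/
def adjunction {a b : V} {y : b ⟶ a} {x : a ⟶ b}
    (i : C.Cell (Path.nil : Path b b) (y.toPath.comp x.toPath))
    (e : C.Cell (x.toPath.comp y.toPath) (Path.nil : Path a a))
    (hl : C.vcomp (C.hcomp (f := Path.nil) (f' := y.toPath.comp x.toPath) i (C.id y.toPath))
      (C.hcomp (C.id y.toPath) (g := x.toPath.comp y.toPath) (g' := Path.nil) e) =
      C.id y.toPath)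
    (hr : C.vcomp (C.hcomp (C.id x.toPath) (g := Path.nil) (g' := y.toPath.comp x.toPath) i)
      (C.hcomp (f := x.toPath.comp y.toPath) (f' := Path.nil) e (C.id x.toPath)) =
      C.id x.toPath) :
    Bicategory.Adjunction (B := C.Obj) (a := b) (b := a) y.toPath x.toPath where
  unit := i
  counit := e
  left_triangle :=
    (leftZigzag_eq (B := C.Obj) (f := y.toPath) (g := x.toPath) i e).trans
      ((congrArg (C.vcomp (h := y.toPath) _) (C.id_vcomp (g := y.toPath) _)).trans
        (hl.trans (C.id_vcomp _).symm))
  right_triangle :=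
    (rightZigzag_eq (B := C.Obj) (f := y.toPath) (g := x.toPath) i e).trans
      ((congrArg (C.vcomp (h := x.toPath) _) (C.id_vcomp (g := x.toPath) _)).trans
        (hr.trans (C.id_vcomp _).symm))

end

end PathTwoCat

namespace FormalAdj

open PathTwoCat TwoPolygraph

variable {V : Type u} [Quiver.{v} V]

/-- The 1-generator `f^(n+1)`, for a 1-generator `f^n`. -/
def succ {A B : FormalAdj V} : (A ⟶ B) → (B ⟶ A)
  | .even f n hn => .odd f (n + 1) hn.add_one
  | .odd f n hn => .even f (n + 1) hn.add_one

theorem succ_pred {A B : FormalAdj V} : ∀ x : A ⟶ B, succ (pred x) = x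
  | .even f n hn => by
    change Arrow.even f (n - 1 + 1) _ = _
    congr 1
    omega
  | .odd f n hn => by
    change Arrow.odd f (n - 1 + 1) _ = _
    congr 1
    omega

/-- The winding number of the 1-generator to which a 3-generator belongs. -/
def ruleWind {E : TwoPolygraph.{w} V} {A B : FormalAdj V} {f g : Path A B}
    {α β : (twoPolygraph E).free.Cell f g} : Gen₃ E α β → ℤ
  | .l x => wind x
  | .r x => wind x

/-- The 3-polygraph of formal adjoints, with only the 3-generators that belong to 1-generators of
winding number in `(-N, N]`. -/
abbrev truncated (E : TwoPolygraph.{w} V) (N : ℕ) : ThreePolygraph (FormalAdj V) where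
  toTwoPolygraph := twoPolygraph E
  Gen₃ α β := {r : Gen₃ E α β // -(N : ℤ) < ruleWind r ∧ ruleWind r ≤ N}

variable {E : TwoPolygraph.{w} V} {A B : FormalAdj V} {f g : Path A B}
  {α β : (polygraph E).free.Cell f g}

theorem truncated_step_mono {M N : ℕ} (h : M ≤ N) (s : (truncated E M).Step α β) :
    (truncated E N).Step α β := by
  obtain ⟨⟨r, hr⟩, K⟩ := s
  exact .mk (F := truncated E N) ⟨r, by omega, by omega⟩ K

theorem exists_truncated_step (s : (polygraph E).Step α β) : ∃ N, (truncated E N).Step α β := by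
  obtain ⟨r, K⟩ := s
  exact ⟨(ruleWind r).natAbs + 1, .mk (F := truncated E _) ⟨r, by omega, by omega⟩ K⟩

theorem truncated_mk_eq_mono {M N : ℕ} (h : M ≤ N)
    (e : (Quot.mk _ α : (truncated E M).presented.Cell f g) = Quot.mk _ β) :
    (Quot.mk _ α : (truncated E N).presented.Cell f g) = Quot.mk _ β :=
  congrArg (Quot.map id fun _ _ => truncated_step_mono h) e

theorem exists_truncated_mk_eq
    (h : (Quot.mk _ α : (polygraph E).presented.Cell f g) = Quot.mk _ β) :
    ∃ N, (Quot.mk _ α : (truncated E N).presented.Cell f g) = Quot.mk _ β := by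
  induction Quot.eqvGen_exact h with
  | rel α β s =>
    obtain ⟨N, hN⟩ := exists_truncated_step s
    exact ⟨N, Quot.sound hN⟩
  | refl α => exact ⟨0, rfl⟩
  | symm α β s ih =>
    obtain ⟨N, hN⟩ := ih (Quot.eqvGen_sound s)
    exact ⟨N, hN.symm⟩
  | trans α β γ s t ih ih' =>
    obtain ⟨M, hM⟩ := ih (Quot.eqvGen_sound s)
    obtain ⟨N, hN⟩ := ih' (Quot.eqvGen_sound t)
    exact ⟨max M N, (truncated_mk_eq_mono (le_max_left M N) hM).trans
      (truncated_mk_eq_mono (le_max_right M N) hN)⟩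

theorem truncated_mk_eq_of_rule {N : ℕ} (r : Gen₃ E α β) (h : -(N : ℤ) < ruleWind r)
    (h' : ruleWind r ≤ N) :
    (Quot.mk _ α : (truncated E N).presented.Cell f g) = Quot.mk _ β :=
  Quot.sound (.of_gen₃ (F := truncated E N) ⟨r, h, h'⟩)

/-- The adjunction between `f^(n-1)` and `f^n` when the 3-generators of `f^n` have been kept. -/
def truncatedAdjunction {N : ℕ} (x : A ⟶ B) (h : -(N : ℤ) < wind x) (h' : wind x ≤ N) :
    Bicategory.Adjunction (B := (truncated E N).presented.Obj) (a := B) (b := A)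
      (pred x).toPath x.toPath :=
  (truncated E N).presented.adjunction (y := pred x) (x := x) (Quot.mk _ (η E x))
    (Quot.mk _ (FormalAdj.ε E x)) (truncated_mk_eq_of_rule (.l x) h h')
    (truncated_mk_eq_of_rule (.r x) h h')

end FormalAdj

namespace PathTwoCat

open Bicategory

variable {B : Type u} [Bicategory.{w, v} B] [Strict B]

theorem map₂_whiskerComp_heq {C : Type u'} [Bicategory.{w', v'} C]
    (Ψ : StrictPseudofunctor B C) {a b c : B} {f f' : a ⟶ b} {g g' : b ⟶ c} (α : f ⟶ f')
    (β : g ⟶ g') :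
    Ψ.map₂ (whiskerComp α β) ≍ whiskerComp (Ψ.map₂ α) (Ψ.map₂ β) := by
  have : Ψ.map₂ (whiskerComp α β) = eqToHom (Ψ.map_comp f g) ≫
      whiskerComp (Ψ.map₂ α) (Ψ.map₂ β) ≫ eqToHom (Ψ.map_comp f' g').symm := by
    simp [whiskerComp, Ψ.map₂_whisker_left, Ψ.map₂_whisker_right, Ψ.mapComp_eq_eqToIso]
  rw [this]
  exact eqToHom_conj_heq _ _ _

section

variable {a b : B} {l : b ⟶ a} {r : a ⟶ b} (adj : Bicategory.Adjunction l r)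
  {i : b ⟶ b} {i' : a ⟶ a} {m : b ⟶ b} {m' : a ⟶ a} (hi : i = 𝟙 b) (hm : l ≫ r = m)
  (hm' : m' = r ≫ l) (hi' : 𝟙 a = i')

theorem eqToHom_conj_left_triangle {k : b ⟶ a} (hl : l = i ≫ l) (hk : m ≫ l = k)
    (hk' : k = l ≫ m') (hl' : l ≫ i' = l) :
    (eqToHom hl ≫ whiskerComp (eqToHom hi ≫ adj.unit ≫ eqToHom hm) (𝟙 l) ≫ eqToHom hk) ≫
      (eqToHom hk' ≫ whiskerComp (𝟙 l) (eqToHom hm' ≫ adj.counit ≫ eqToHom hi') ≫ eqToHom hl') =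
      𝟙 l := by
  have h := adj.left_triangle
  rw [leftZigzag_eq, Strict.associator_eqToIso, Strict.leftUnitor_eqToIso,
    Strict.rightUnitor_eqToIso, eqToIso.hom, eqToIso.hom, eqToIso.inv] at h
  subst hi hm hm' hi' hk
  simp [whiskerComp, reassoc_of% h]

theorem eqToHom_conj_right_triangle {k : a ⟶ b} (hr : r = r ≫ i) (hk : r ≫ m = k)
    (hk' : k = m' ≫ r) (hr' : i' ≫ r = r) :
    (eqToHom hr ≫ whiskerComp (𝟙 r) (eqToHom hi ≫ adj.unit ≫ eqToHom hm) ≫ eqToHom hk) ≫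
      (eqToHom hk' ≫ whiskerComp (eqToHom hm' ≫ adj.counit ≫ eqToHom hi') (𝟙 r) ≫ eqToHom hr') =
      𝟙 r := by
  have h := adj.right_triangle
  rw [rightZigzag_eq, Strict.associator_eqToIso, Strict.leftUnitor_eqToIso,
    Strict.rightUnitor_eqToIso, eqToIso.inv, eqToIso.hom, eqToIso.inv] at h
  subst hi hm hm' hi' hk
  simp [whiskerComp, reassoc_of% h]

end

variable {V : Type u'} [Quiver.{v'} V] (Φ : Paths V ⥤ B) {a b : V} {y : b ⟶ a} {x : a ⟶ b}
  (adj : Bicategory.Adjunction (Φ.map y.toPath) (Φ.map x.toPath))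

/-- The unit of an adjunction in `B`, as a 2-cell of `pullback Φ`. -/
def pullbackUnit : (pullback Φ).Cell (Path.nil : Path b b) (y.toPath.comp x.toPath) :=
  eqToHom (Φ.map_id b) ≫ adj.unit ≫ eqToHom (Φ.map_comp y.toPath x.toPath).symm

/-- The counit of an adjunction in `B`, as a 2-cell of `pullback Φ`. -/
def pullbackCounit : (pullback Φ).Cell (x.toPath.comp y.toPath) (Path.nil : Path a a) :=
  eqToHom (Φ.map_comp x.toPath y.toPath) ≫ adj.counit ≫ eqToHom (Φ.map_id a).symm

theorem pullback_left_triangle :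
    (pullback Φ).vcomp
      ((pullback Φ).hcomp (f := Path.nil) (f' := y.toPath.comp x.toPath) (pullbackUnit Φ adj)
        ((pullback Φ).id y.toPath))
      ((pullback Φ).hcomp ((pullback Φ).id y.toPath) (g := x.toPath.comp y.toPath)
        (g' := Path.nil) (pullbackCounit Φ adj)) = (pullback Φ).id y.toPath :=
  eqToHom_conj_left_triangle adj ..

theorem pullback_right_triangle :
    (pullback Φ).vcomp
      ((pullback Φ).hcomp ((pullback Φ).id x.toPath) (g := Path.nil)
        (g' := y.toPath.comp x.toPath) (pullbackUnit Φ adj))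
      ((pullback Φ).hcomp (f := x.toPath.comp y.toPath) (f' := Path.nil) (pullbackCounit Φ adj)
        ((pullback Φ).id x.toPath)) = (pullback Φ).id x.toPath :=
  eqToHom_conj_right_triangle adj ..

end PathTwoCat

namespace PathTwoCat

theorem eqToHom_conj_comp {C : Type u} [Category.{v} C] {X Y Z X' Y' Z' : C} (hX : X' = X)
    (hY : Y = Y') (hZ : Z = Z') (f : X ⟶ Y) (g : Y ⟶ Z) :
    eqToHom hX ≫ (f ≫ g) ≫ eqToHom hZ =
      (eqToHom hX ≫ f ≫ eqToHom hY) ≫ eqToHom hY.symm ≫ g ≫ eqToHom hZ := by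
  simp

end PathTwoCat

namespace FormalAdj

open PathTwoCat PathTwoCat.Total TwoPolygraph Bicategory

/-- An action of all the 1-generators `f^n` on the images of the 0-cells under a strict 2-functor
`Ψ : E^* → B`, such that `f^0` acts as `Ψ f`. -/
structure WindingAction {V : Type u} [Quiver.{v} V] {E : TwoPolygraph.{w} V} {B : Type u'}
    [Bicategory.{w', v'} B] (Ψ : StrictPseudofunctor E.free.Obj B) where
  map : ∀ {A A' : FormalAdj V}, (A ⟶ A') → (Ψ.obj A ⟶ Ψ.obj A')
  map_zero : ∀ {A A' : V} (y : A ⟶ A'), map ((zero V).map y) = Ψ.map y.toPath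

namespace WindingAction

variable {V : Type u} [Quiver.{v} V] {E : TwoPolygraph.{w} V} {B : Type u'}
  [Bicategory.{w', v'} B] [Strict B] {Ψ : StrictPseudofunctor E.free.Obj B} (L : WindingAction Ψ)

/-- The action of the paths of 1-generators. -/
abbrev functor : Paths (FormalAdj V) ⥤ B :=
  Paths.lift (V := FormalAdj V) { obj := fun A => Ψ.obj A, map := L.map }

theorem functor_map_toPath {A A' : FormalAdj V} (x : A ⟶ A') :
    L.functor.map x.toPath = L.map x :=
  Category.id_comp _

theorem functor_map_mapPath_zero {A A' : V} (f : Path A A') :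
    L.functor.map ((zero V).mapPath f) = Ψ.map f := by
  induction f with
  | nil => exact (Ψ.map_id _).symm
  | cons f y ih =>
    exact (congrArg₂ (· ≫ ·) ih (L.map_zero y)).trans (Ψ.map_comp (b := _) f y.toPath).symm

/-- The image of a 2-cell of `E^*` under `Ψ`, as a 2-cell between paths of 1-generators `f^0`. -/
def conj {A A' : E.free.Obj} {f g : A ⟶ A'} (α : f ⟶ g) :
    (pullback L.functor).Cell ((zero V).mapPath f) ((zero V).mapPath g) :=
  eqToHom (L.functor_map_mapPath_zero f) ≫ Ψ.map₂ α ≫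
    eqToHom (L.functor_map_mapPath_zero g).symm

theorem conj_heq {A A' : E.free.Obj} {f g : A ⟶ A'} (α : f ⟶ g) : L.conj α ≍ Ψ.map₂ α :=
  eqToHom_conj_heq _ _ _

theorem conj_injective {A A' : E.free.Obj} {f g : A ⟶ A'} {α β : f ⟶ g}
    (h : L.conj α = L.conj β) : Ψ.map₂ α = Ψ.map₂ β :=
  eq_of_heq ((L.conj_heq α).symm.trans ((heq_of_eq h).trans (L.conj_heq β)))

theorem conj_id {A A' : E.free.Obj} (f : A ⟶ A') :
    L.conj (E.free.id f) = (pullback L.functor).id ((zero V).mapPath f) :=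
  eq_of_heq ((L.conj_heq (𝟙 f)).trans ((heq_of_eq (Ψ.map₂_id f)).trans
    (id_heq_id (L.functor_map_mapPath_zero f).symm)))

theorem conj_vcomp {A A' : E.free.Obj} {f g h : A ⟶ A'} (α : f ⟶ g) (β : g ⟶ h) :
    L.conj (E.free.vcomp α β) = (pullback L.functor).vcomp (L.conj α) (L.conj β) := by
  have h' := congrArg (eqToHom (L.functor_map_mapPath_zero f) ≫ · ≫
    eqToHom (L.functor_map_mapPath_zero h).symm) (Ψ.map₂_comp α β)
  exact h'.trans (eqToHom_conj_comp _ (L.functor_map_mapPath_zero g).symm _ _ _)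

theorem conj_hcomp_heq {A A' A'' : E.free.Obj} {f f' : A ⟶ A'} {g g' : A' ⟶ A''} (α : f ⟶ f')
    (β : g ⟶ g') :
    L.conj (E.free.hcomp α β) ≍ (pullback L.functor).hcomp (L.conj α) (L.conj β) := by
  refine (L.conj_heq (f := f ≫ g) (g := f' ≫ g') _).trans
    (HEq.trans ?_ (eqToHom_conj_heq _ _ _).symm)
  have h := congrArg Ψ.map₂ (E.free.hcomp_eq_vcomp α β)
  refine (heq_of_eq h).trans ((map₂_whiskerComp_heq Ψ α β).trans ?_)
  exact whiskerComp_heq (L.functor_map_mapPath_zero f).symm (L.functor_map_mapPath_zero f').symm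
    (L.functor_map_mapPath_zero g).symm (L.functor_map_mapPath_zero g').symm
    (L.conj_heq α).symm (L.conj_heq β).symm

open Classical in
/-- The interpretation of the 2-generators which extends `Ψ` by the unit and counit of a chosen
adjunction between the actions of `f^(n-1)` and `f^n`, whenever there is one. -/
noncomputable def interp {A A' : FormalAdj V} {f g : Path A A'} :
    (polygraph E).Gen f g → (pullback L.functor).withBot.Cell f g
  | .base α => some (L.conj (E.of α))
  | .unit x =>
    if h : Nonempty (Bicategory.Adjunction (L.functor.map (pred x).toPath)
        (L.functor.map x.toPath))
    then some (pullbackUnit L.functor h.some) else none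
  | .counit x =>
    if h : Nonempty (Bicategory.Adjunction (L.functor.map (pred x).toPath)
        (L.functor.map x.toPath))
    then some (pullbackCounit L.functor h.some) else none

theorem eval_zeroTotal {A A' : V} {f g : Path A A'} (α : E.free.Cell f g) :
    eval _ L.interp (zeroTotal α).cell = some (L.conj α) := by
  induction α using free_induction with
  | of α => rfl
  | id f => exact congrArg some (L.conj_id f).symm
  | @vcomp A A' f g h α β hα hβ =>
    have e : (zeroTotal (E.free.vcomp α β)).cell =
        (polygraph E).free.vcomp (zeroTotal α).cell (zeroTotal β).cell := eval_vcomp _ _ α β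
    refine (congrArg (eval _ L.interp) e).trans ((eval_vcomp _ _ _ _).trans ?_)
    exact (congrArg₂ (Option.map₂ _) hα hβ).trans (congrArg some (L.conj_vcomp α β).symm)
  | @hcomp A A' A'' f f' g g' α β hα hβ =>
    have e : (zeroTotal (E.free.hcomp α β)).cell = (polygraph E).free.castCell _ _
        ((polygraph E).free.hcomp (zeroTotal α).cell (zeroTotal β).cell) := eval_hcomp _ _ α β
    refine eq_of_heq ((heq_of_eq (congrArg (eval _ L.interp) e)).trans
      ((eval_castCell_heq _ _ _ _ _).trans ?_))
    refine (heq_of_eq ((eval_hcomp _ _ _ _).trans (congrArg₂ (Option.map₂ _) hα hβ))).trans ?_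
    exact (some_heq _ (Prefunctor.mapPath_comp ..) (Prefunctor.mapPath_comp ..)
      (L.conj_hcomp_heq α β)).symm

theorem interp_unit {A A' : FormalAdj V} {x : A ⟶ A'}
    (h : Nonempty (Bicategory.Adjunction (L.functor.map (pred x).toPath)
      (L.functor.map x.toPath))) :
    L.interp (.unit x) = some (pullbackUnit L.functor h.some) :=
  dif_pos h

theorem interp_counit {A A' : FormalAdj V} {x : A ⟶ A'}
    (h : Nonempty (Bicategory.Adjunction (L.functor.map (pred x).toPath)
      (L.functor.map x.toPath))) :
    L.interp (.counit x) = some (pullbackCounit L.functor h.some) :=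
  dif_pos h

theorem eval_rule {A A' : FormalAdj V} {f g : Path A A'} {α β : (twoPolygraph E).free.Cell f g}
    (r : Gen₃ E α β) (h : ∀ {A A' : FormalAdj V} (x : A ⟶ A'), wind x = ruleWind r →
      Nonempty (Bicategory.Adjunction (L.map (pred x)) (L.map x))) :
    eval _ L.interp α = eval _ L.interp β := by
  have h' : ∀ {A A' : FormalAdj V} (x : A ⟶ A'), wind x = ruleWind r → Nonempty
      (Bicategory.Adjunction (L.functor.map (pred x).toPath) (L.functor.map x.toPath)) :=
    fun x hx => by
      rw [L.functor_map_toPath, L.functor_map_toPath]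
      exact h x hx
  cases r with
  | l x =>
    change PathTwoCat.vcomp _ (PathTwoCat.hcomp _ (f := Path.nil)
      (f' := (pred x).toPath.comp x.toPath) (L.interp (.unit x)) (PathTwoCat.id _ (pred x).toPath))
      (PathTwoCat.hcomp _ (PathTwoCat.id _ (pred x).toPath) (g := x.toPath.comp (pred x).toPath)
        (g' := Path.nil) (L.interp (.counit x))) = PathTwoCat.id _ (pred x).toPath
    rw [L.interp_unit (h' x rfl), L.interp_counit (h' x rfl)]
    exact congrArg some (pullback_left_triangle L.functor (h' x rfl).some)
  | r x =>
    change PathTwoCat.vcomp _ (PathTwoCat.hcomp _ (PathTwoCat.id _ x.toPath) (g := Path.nil)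
      (g' := (pred x).toPath.comp x.toPath) (L.interp (.unit x)))
      (PathTwoCat.hcomp _ (f := x.toPath.comp (pred x).toPath) (f' := Path.nil)
        (L.interp (.counit x)) (PathTwoCat.id _ x.toPath)) = PathTwoCat.id _ x.toPath
    rw [L.interp_unit (h' x rfl), L.interp_counit (h' x rfl)]
    exact congrArg some (pullback_right_triangle L.functor (h' x rfl).some)

theorem map₂_eq_of_truncated_mk_eq {N : ℕ}
    (h : ∀ {A A' : FormalAdj V} (x : A ⟶ A'), -(N : ℤ) < wind x → wind x ≤ N →
      Nonempty (Bicategory.Adjunction (L.map (pred x)) (L.map x)))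
    {A A' : E.free.Obj} {f g : A ⟶ A'} {α β : f ⟶ g}
    (e : (Quot.mk _ (zeroTotal α).cell : (truncated E N).presented.Cell _ _) =
      Quot.mk _ (zeroTotal β).cell) :
    Ψ.map₂ α = Ψ.map₂ β := by
  have key : ∀ {A A' : FormalAdj V} {p q : Path A A'} (γ δ : (polygraph E).free.Cell p q),
      (truncated E N).Step γ δ → eval _ L.interp γ = eval _ L.interp δ := by
    rintro A A' p q _ _ ⟨⟨r, hr⟩, K⟩
    exact K.eval_apply_congr _ _ (L.eval_rule r fun x hx => h x (by omega) (by omega))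
  have e' := congrArg (Quot.lift (eval _ L.interp) key) e
  exact L.conj_injective (Option.some.inj
    ((L.eval_zeroTotal α).symm.trans (e'.trans (L.eval_zeroTotal β))))

end WindingAction

end FormalAdj

namespace PathTwoCat

open Bicategory

theorem natTrans_heq {C : Type u} {D : Type u'} [Category.{v} C] [Category.{v'} D]
    {F G F' G' : C ⥤ D} (hF : F = F') (hG : G = G') {α : F ⟶ G} {β : F' ⟶ G'}
    (h : ∀ X, α.app X ≍ β.app X) : α ≍ β := by
  subst hF hG
  exact heq_of_eq (NatTrans.ext (funext fun X => eq_of_heq (h X)))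

theorem toCatHom₂_whiskeringLeft_map_heq {C D : Type u} [Category.{v} C] [Category.{v} D]
    {T : Type u'} [Category.{v'} T] {F G F' G' : C ⥤ D} (hF : F = F') (hG : G = G')
    {α : F ⟶ G} {β : F' ⟶ G'} (h : α ≍ β) :
    NatTrans.toCatHom₂ ((Functor.whiskeringLeft C D T).map α) ≍
      NatTrans.toCatHom₂ ((Functor.whiskeringLeft C D T).map β) := by
  subst hF hG h
  rfl

section

variable {B : Type u} [Bicategory.{max v w, v} B] [Strict B] (X : B)

theorem precomp_id (a : B) : precomp X (𝟙 a) = 𝟭 _ := by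
  refine Functor.hext (fun h => Strict.id_comp h) fun h k α => ?_
  change 𝟙 a ◁ α ≍ α
  rw [id_whiskerLeft, Strict.leftUnitor_eqToIso, Strict.leftUnitor_eqToIso, eqToIso.hom,
    eqToIso.inv]
  exact eqToHom_conj_heq _ _ _

theorem precomp_comp {a b c : B} (f : a ⟶ b) (g : b ⟶ c) :
    precomp X (f ≫ g) = precomp X g ⋙ precomp X f := by
  refine Functor.hext (fun h => Strict.assoc f g h) fun h k α => ?_
  change (f ≫ g) ◁ α ≍ f ◁ g ◁ α
  rw [comp_whiskerLeft, Strict.associator_eqToIso, Strict.associator_eqToIso, eqToIso.hom,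
    eqToIso.inv]
  exact eqToHom_conj_heq _ _ _

theorem precomposing_map_whiskerLeft_heq {a b c : B} (f : a ⟶ b) {g g' : b ⟶ c} (β : g ⟶ g') :
    (precomposing a c X).map (f ◁ β) ≍
      Functor.whiskerRight ((precomposing b c X).map β) (precomp X f) := by
  refine natTrans_heq (precomp_comp X f g) (precomp_comp X f g') fun h => ?_
  change (f ◁ β) ▷ h ≍ f ◁ β ▷ h
  rw [whisker_assoc, Strict.associator_eqToIso, Strict.associator_eqToIso, eqToIso.hom,
    eqToIso.inv]
  exact eqToHom_conj_heq _ _ _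

theorem precomposing_map_whiskerRight_heq {a b c : B} {f f' : a ⟶ b} (α : f ⟶ f') (g : b ⟶ c) :
    (precomposing a c X).map (α ▷ g) ≍
      Functor.whiskerLeft (precomp X g) ((precomposing a b X).map α) := by
  refine natTrans_heq (precomp_comp X f g) (precomp_comp X f' g) fun h => ?_
  change (α ▷ g) ▷ h ≍ α ▷ (g ≫ h)
  rw [whiskerRight_comp, Strict.associator_eqToIso, Strict.associator_eqToIso, eqToIso.hom,
    eqToIso.inv]
  exact (eqToHom_conj_heq _ _ _).symm

/-- The action by precomposition of the 1-cells on the copresheaves on the categories `a ⟶ X`. -/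
def star : StrictPseudofunctor B Cat.{max v w, max v w + 1} :=
  .mk'' {
    obj a := Cat.of ((a ⟶ X) ⥤ Type (max v w))
    map f := ((Functor.whiskeringLeft _ _ _).obj (precomp X f)).toCatHom
    map₂ {a b _ _} α := ((Functor.whiskeringLeft _ _ _).map ((precomposing a b X).map α)).toCatHom₂
    map_id a := by rw [precomp_id]; rfl
    map_comp f g := by rw [precomp_comp]; rfl
    map₂_id {a b} f := congrArg NatTrans.toCatHom₂
      ((precomposing a b X ⋙ Functor.whiskeringLeft _ _ _).map_id f)
    map₂_comp {a b _ _ _} α β := congrArg NatTrans.toCatHom₂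
      ((precomposing a b X ⋙ Functor.whiskeringLeft _ _ _).map_comp α β)
    map₂_whisker_left f g g' β := (conj_eqToHom_iff_heq' ..).2
      (toCatHom₂_whiskeringLeft_map_heq (precomp_comp X f g) (precomp_comp X f g')
        (precomposing_map_whiskerLeft_heq X f β))
    map₂_whisker_right {_ _ _ f f'} α g := (conj_eqToHom_iff_heq' ..).2
      (toCatHom₂_whiskeringLeft_map_heq (precomp_comp X f g) (precomp_comp X f' g)
        (precomposing_map_whiskerRight_heq X α g)) }

theorem star_map₂_injective {a : B} {f g : a ⟶ X} {α β : f ⟶ g}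
    (h : (star.{w} X).map₂ α = (star X).map₂ β) : α = β := by
  have h_map : (coyoneda.obj (.op (f ≫ 𝟙 X))).map (α ▷ 𝟙 X) =
      (coyoneda.obj (.op (f ≫ 𝟙 X))).map (β ▷ 𝟙 X) :=
    congrArg (fun θ => (θ.toNatTrans.app (coyoneda.obj (.op (f ≫ 𝟙 X)))).app (𝟙 X)) h
  have h_whisker : α ▷ 𝟙 X = β ▷ 𝟙 X :=
    (Category.id_comp _).symm.trans ((congrArg (fun θ => θ.hom (𝟙 (f ≫ 𝟙 X))) h_map).trans
      (Category.id_comp _))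
  simpa using h_whisker

variable {a b : B} (f : a ⟶ b)

/-- The right adjoint of `(star X).map f`, given by right Kan extension. -/
noncomputable def ran : (star.{w} X).obj b ⟶ (star.{w} X).obj a := (precomp X f).ran.toCatHom

/-- The left adjoint of `(star X).map f`, given by left Kan extension. -/
noncomputable def lan : (star.{w} X).obj b ⟶ (star.{w} X).obj a := (precomp X f).lan.toCatHom

/-- Right Kan extension along precomposition with `f` is right adjoint to the action of `f`. -/
noncomputable def starRanAdjunction : Bicategory.Adjunction ((star.{w} X).map f) (ran X f) :=
  ((precomp X f).ranAdjunction _).toCat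

/-- Left Kan extension along precomposition with `f` is left adjoint to the action of `f`. -/
noncomputable def lanStarAdjunction : Bicategory.Adjunction (lan X f) ((star.{w} X).map f) :=
  ((precomp X f).lanAdjunction _).toCat

end

end PathTwoCat

namespace FormalAdj

open PathTwoCat TwoPolygraph Bicategory

variable {V : Type u} [Quiver.{v} V] {E : TwoPolygraph.{w} V} (N : ℕ)
  (X : (truncated E N).presented.Obj)

/-- The functors by which the `f^n` with `|n| ≤ N + 1` act on copresheaves: precomposition in the
2-category presented by the rules for winding numbers in `(-N, N]`, and, for `|n| = N + 1`, the
Kan extension which is the missing adjoint. For larger `|n|` the value is junk. -/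
noncomputable def kanAction {A A' : FormalAdj V} (x : A ⟶ A') :
    (star.{w} X).obj A ⟶ (star.{w} X).obj A' :=
  if wind x = N + 1 then
    ran.{w} (B := (truncated E N).presented.Obj) (a := A') (b := A) X (pred x).toPath
  else if wind x = -(N + 1) then
    lan.{w} (B := (truncated E N).presented.Obj) (a := A') (b := A) X (succ x).toPath
  else (star.{w} X).map (X := A) (Y := A') x.toPath

variable {N X} {A A' : FormalAdj V} {x : A ⟶ A'}

theorem kanAction_of_wind_eq (h : wind x = N + 1) :
    kanAction N X x =
      ran.{w} (B := (truncated E N).presented.Obj) (a := A') (b := A) X (pred x).toPath :=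
  if_pos h

theorem kanAction_of_wind_eq_neg (h : wind x = -(N + 1)) :
    kanAction N X x =
      lan.{w} (B := (truncated E N).presented.Obj) (a := A') (b := A) X (succ x).toPath :=
  (if_neg (by omega)).trans (if_pos h)

theorem kanAction_of_le (h : -(N : ℤ) ≤ wind x) (h' : wind x ≤ N) :
    kanAction N X x = (star.{w} X).map (X := A) (Y := A') x.toPath :=
  (if_neg (by omega)).trans (if_neg (by omega))

theorem nonempty_kanAction_adjunction (x : A ⟶ A') (h : -((N + 1 : ℕ) : ℤ) < wind x)
    (h' : wind x ≤ (N + 1 : ℕ)) :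
    Nonempty (Bicategory.Adjunction (kanAction N X (pred x)) (kanAction N X x)) := by
  push_cast at h h'
  have h_pred := wind_pred x
  by_cases h_top : wind x = N + 1
  · rw [kanAction_of_wind_eq h_top, kanAction_of_le (by omega) (by omega)]
    exact ⟨starRanAdjunction (B := (truncated E N).presented.Obj) X _⟩
  by_cases h_bot : wind x = -N
  · rw [kanAction_of_le (x := x) (by omega) (by omega), kanAction_of_wind_eq_neg (by omega),
      succ_pred]
    exact ⟨lanStarAdjunction (B := (truncated E N).presented.Obj) X _⟩
  rw [kanAction_of_le (x := x) (by omega) (by omega), kanAction_of_le (by omega) (by omega)]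
  exact ⟨(star X).mapAdjunction (truncatedAdjunction x (by omega) (by omega))⟩

variable (E N) in
/-- The canonical 2-functor from `E^*` to the 2-category presented by the rules for winding
numbers in `(-N, N]`. -/
def truncatedEmbedding : StrictPseudofunctor E.free.Obj (truncated E N).presented.Obj :=
  TwoPolygraph.lift (zero V) (truncated E N).presented
    fun β => Quot.mk _ ((polygraph E).of (.base β))

theorem truncatedEmbedding_map₂ {A A' : E.free.Obj} {f g : A ⟶ A'} (α : f ⟶ g) :
    (truncatedEmbedding E N).map₂ α = Quot.mk _ (zeroTotal α).cell :=
  (truncated E N).eval_comap_presented (zero V) _ α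

variable (N X) in
/-- The action of the `f^n` on copresheaves which extends the one of `E^*` through the 2-category
presented by the rules for winding numbers in `(-N, N]`, and in which the Kan
extensions provide the adjunctions of the next stage. -/
noncomputable def kanWindingAction :
    WindingAction ((truncatedEmbedding E N).comp (star.{w} X)) where
  map := kanAction N X
  map_zero _ := kanAction_of_le (neg_nonpos.2 (Nat.cast_nonneg N)) (Nat.cast_nonneg N)

/-- An action of the `f^n` extending the one of `E^*` by precomposition. Only its value at `n = 0`
matters, since no rule has its winding number in `(0, 0]`. -/
noncomputable def starWindingAction (X : E.free.Obj) : WindingAction (star.{w} X) where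
  map
    | .even f _ _ => (star.{w} X).map f.toPath
    | .odd f _ _ => ran.{w} (B := E.free.Obj) X f.toPath
  map_zero _ := rfl

theorem eq_of_truncatedEmbedding_map₂_eq {A A' : E.free.Obj} {f g : A ⟶ A'} {α β : f ⟶ g}
    (h : (truncatedEmbedding E N).map₂ α = (truncatedEmbedding E N).map₂ β) : α = β := by
  induction N with
  | zero =>
    rw [truncatedEmbedding_map₂, truncatedEmbedding_map₂] at h
    exact star_map₂_injective.{w} A'
      ((starWindingAction A').map₂_eq_of_truncated_mk_eq (fun x h h' => by omega) h)
  | succ N ih =>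
    rw [truncatedEmbedding_map₂, truncatedEmbedding_map₂] at h
    exact ih (star_map₂_injective.{w} (B := (truncated E N).presented.Obj) A'
      ((kanWindingAction N A').map₂_eq_of_truncated_mk_eq nonempty_kanAction_adjunction h))

theorem embedding_map₂_injective {A A' : E.free.Obj} {f g : A ⟶ A'} {α β : f ⟶ g}
    (h : (embedding E).map₂ α = (embedding E).map₂ β) : α = β := by
  rw [embedding_map₂, embedding_map₂] at h
  obtain ⟨N, hN⟩ := exists_truncated_mk_eq h
  refine eq_of_truncatedEmbedding_map₂_eq (N := N) ?_
  rwa [truncatedEmbedding_map₂, truncatedEmbedding_map₂]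

end FormalAdj

theorem mainTheorem2 {V : Type u} [Quiver.{v} V] (E : TwoPolygraph.{w} V) :
    (∀ (A B : E.free.Obj) (f g : A ⟶ B)
      (α : (FormalAdj.toFree E).map f ⟶ (FormalAdj.toFree E).map g),
      (FormalAdj.polygraph E).IsNormalForm α → FormalAdj.unitCounitCount α = 0) ∧
    (∀ (A B : E.free.Obj) (f g : A ⟶ B),
      Set.BijOn (fun α : f ⟶ g => (FormalAdj.toFree E).map₂ α) Set.univ
        {α | (FormalAdj.polygraph E).IsNormalForm α}) ∧
    (∀ A B : E.free.Obj,
      ((FormalAdj.embedding E).mapFunctor A B).Full ∧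
      ((FormalAdj.embedding E).mapFunctor A B).Faithful) := by
  refine ⟨fun A B f g α => (FormalAdj.isNormalForm_iff α).1, fun A B f g => ⟨?_, ?_, ?_⟩,
    fun A B => ⟨⟨?_⟩, ⟨?_⟩⟩⟩
  · exact fun α _ => (FormalAdj.isNormalForm_iff _).2 (FormalAdj.weight_zeroTotal α)
  · intro α _ β _ h
    refine FormalAdj.embedding_map₂_injective ?_
    rw [FormalAdj.embedding_map₂, FormalAdj.embedding_map₂]
    exact congrArg (Quot.mk _) h
  · intro α hα
    obtain ⟨β, hβ⟩ := FormalAdj.exists_map₂_toFree_eq α ((FormalAdj.isNormalForm_iff α).1 hα)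
    exact ⟨β, trivial, hβ⟩
  · rintro f g ⟨α⟩
    exact FormalAdj.exists_embedding_map₂_eq α
  · exact fun h => FormalAdj.embedding_map₂_injective h
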